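/- **Setting.** Let $\mathfrak g$ be a finite-dimensional simple complex Lie algebra with Dynkin nodes $I$ and (indecomposable, finite type) Cartan matrix $C=(C_{i,j})_{i,j\in I}$; let $d_i\in\mathbb N_{>0}$ be the relatively prime integers with $d_iC_{i,j}=d_jC_{j,i}$. Let $q\in\mathbb C^\times$ be not a root of unity, $q_i=q^{d_i}$, and $[m]_x=(x^m-x^{-m})/(x-x^{-1})$, with the usual $q$-factorials and $q$-binomial coefficients. For a coweight $\mu=\sum_i\mu_i\omega_i^\vee$ (so $\alpha_i(\mu)=\mu_i\in\mathbb Z$), the shifted quantum affine algebra $U_q^\mu(\mathfrak g)$ is the unital $\mathbb C$-algebra generated by $x_{i,r}^\pm,\phi_{i,r}^\pm$ ($i\in I$, $r\in\mathbb Z$), with $\phi_{i,0}^+$ and $\phi_{i,\mu_i}^-$ invertible, subject to: all $\phi_{i,r}^\pm$ commute with each other; $$\phi^+_{i,0}x^\pm_{j,r}=q_i^{\pm C_{i,j}}x^\pm_{j,r}\phi^+_{i,0},\qquad \phi^-_{i,\mu_i}x^\pm_{j,r}=q_i^{\mp C_{i,j}}x^\pm_{j,r}\phi^-_{i,\mu_i},\qquad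 [h_{i,m},x^\pm_{j,r}]=\pm\tfrac1m[mC_{i,j}]_{q_i}x^\pm_{j,m+r}\ (m\neq0),$$ $$(q_i-q_i^{-1})[x^+_{i,r},x^-_{j,s}]=\delta_{i,j}(\phi^+_{i,r+s}-\phi^-_{i,r+s}),$$ $$x_{i,r+1}^{\pm}x_{j,s}^{\pm}-q_i^{\pm C_{i,j}}x_{j,s}^{\pm}x_{i,r+1}^{\pm}=q_i^{\pm C_{i,j}}x_{i,r}^{\pm}x_{j,s+1}^{\pm}-x_{j,s+1}^{\pm}x_{i,r}^{\pm},$$ and, for $i\ne j$, $p=1-C_{i,j}$ and $r',r_1,\dots,r_p\in\mathbb Z$, the quantum Serre relations $$\sum_{\pi\in\Sigma_p}\sum_{\ell=0}^p(-1)^\ell\binom{p}{\ell}_{q_i}x^\pm_{i,r_{\pi(1)}}\cdots x^\pm_{i,r_{\pi(\ell)}}x^\pm_{j,r'}x^\pm_{i,r_{\pi(\ell+1)}}\cdots x^\pm_{i,r_{\pi(p)}}=0,$$ where the $h_{i,m}$ are defined by $$\sum_{r\in\mathbb Z}\phi^{\pm}_{i,\pm r}z^{\pm r}=z^{\mu(i,\pm)}\phi^\pm_{i,\mu(i,\pm)}\exp\Big(\pm(q_i-q_i^{-1})\sum_{m>0}h_{i,\pm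 m}z^{\pm m}\Big),\qquad \mu(i,+)=0,\ \mu(i,-)=\mu_i$$ (in particular $\phi^+_{i,r}=0$ for $r<0$ and $\phi^-_{i,r}=0$ for $r>\mu_i$). For $J\subseteq I$ let $\mathfrak g_J$ be the semisimple Lie algebra with Cartan matrix $(C_{i,j})_{i,j\in J}$, and let $\operatorname{res}_J(\mu)=\sum_{j\in J}\mu_j\omega_j^\vee$. For $\nu=\operatorname{res}_J(\mu)$, the algebra $U_q^\nu(\mathfrak g_J)$ is defined by the same presentation with $I$ replaced by $J$ (keeping the $q_j$). Identifying generators gives an algebra morphism $U_q^\nu(\mathfrak g_J)\to U_q^\mu(\mathfrak g)$, and $\operatorname{res}_J^\mu$ denotes restriction of modules along it. *Category $\mathcal O^\mu$.* Order $(\mathbb C^\times)^I$ by $\gamma\le\gamma'$ iff $\gamma'\gamma^{-1}=\big(q_i^{\sum_jn_jC_{i,j}}\big)_{i}$ for some $n_j\in\mathbb N$. For a $U_q^\mu(\mathfrak g)$-module $V$ and $\gamma\in(\mathbb C^\times)^I$ put $V_\gamma^+=\{v:\phi^+_{i,0}v=\gamma_iv\ \forall i\}$ and $V_\gamma^-=\{v:\phi^-_{i,\mu_i}v=\gamma_i^{-1}v\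 \forall i\}$. Then $V$ is in $\mathcal O^\mu$ if $V=\bigoplus_\gamma V_\gamma^+=\bigoplus_\gamma V_\gamma^-$, all $V_\gamma^\pm$ are finite-dimensional, and there are finitely many $\lambda_1,\dots,\lambda_s$ such that every $\gamma$ with $V_\gamma^+\ne0$ or $V_\gamma^-\neq0$ satisfies $\gamma\le\lambda_k$ for some $k$. The category $\mathcal O_J^\nu$ of $U_q^\nu(\mathfrak g_J)$-modules is defined in the same way with $J$ in place of $I$. *Highest $\ell$-weight modules.* A module $W$ in $\mathcal O_J^\nu$ is of highest $\ell$-weight if there are rational functions $\Psi_j(z)\in\mathbb C(z)$ ($j\in J$), regular and non-zero at $z=0$, and a non-zero $w\in W$ with $W=U_q^\nu(\mathfrak g_J)w$, $x_{j,r}^+w=0$ and $\phi^\pm_{j,r}w=\Psi^\pm_{j,r}w$ for all $j\in J$, $r\in\mathbb Z$, where $\Psi^+_{j,r}$ (resp. $\Psi^-_{j,r}$) is the coefficient of $z^r$ in the expansion of $\Psi_j$ at $z=0$ (resp. $z=\infty$). *Inflations.* Let $\nu=\operatorname{res}_J(\mu)$, let $W$ be in $\mathcal O_J^\nu$ and $V$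 in $\mathcal O^\mu$. Then $V$ is a $J$-inflation of $W$ to $\mathfrak g$ with coweight $\mu$ if $\operatorname{res}_J^\mu(V)\simeq W$ as $U_q^\nu(\mathfrak g_J)$-modules and $x_{i,r}^\pm V=0$ for all $i\in I\setminus J$ and $r\in\mathbb Z$. For a module $M$, $\operatorname{rad}M$ is its Jacobson radical (the intersection of its maximal proper submodules) and $\operatorname{top}M=M/\operatorname{rad}M$ is its head. **Proposition.** Let $J\subseteq I$, let $\mu$ be a coweight of $\mathfrak g$ and $\nu=\operatorname{res}_J(\mu)$. Let $W$ be a highest $\ell$-weight module in $\mathcal O_J^\nu$ and let $V$ be a $J$-inflation of $W$ to $\mathfrak g$ with coweight $\mu$. Then $\operatorname{rad}V$ is a $J$-inflation of $\operatorname{rad}W$ to $\mathfrak g$ with coweight $\mu$, and $\operatorname{top}V$ is a $J$-inflation of $\operatorname{top}W$ to $\mathfrak g$ with coweight $\mu$. -/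

import Mathlib

open scoped BigOperators

/-! ### Cartan data -/

/-- A matrix `C` (to be a Cartan matrix) and the diagonal entries `d` of a symmetrizing matrix. -/
structure CartanDatum (I : Type*) where
  C : Matrix I I ℤ
  d : I → ℕ

namespace CartanDatum

variable {I : Type*}

/-- `C` is the indecomposable Cartan matrix of finite type of a finite-dimensional simple
Lie algebra, and `d` is its relatively prime positive symmetrizer: `d_i C_{i,j} = d_j C_{j,i}`. -/
structure IsSimple [Fintype I] (D : CartanDatum I) : Prop where
  nonempty : Nonempty I
  diag : ∀ i, D.C i i = 2
  offDiag : ∀ i j, i ≠ j → D.C i j ≤ 0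
  d_pos : ∀ i, 0 < D.d i
  d_coprime : Finset.univ.gcd D.d = 1
  symm : ∀ i j, (D.d i : ℤ) * D.C i j = (D.d j : ℤ) * D.C j i
  posDef : (Matrix.of fun i j => (D.d i : ℝ) * (D.C i j : ℝ)).PosDef
  indecomposable : ∀ S : Set I, S.Nonempty → Sᶜ.Nonempty → ∃ i ∈ S, ∃ j ∈ Sᶜ, D.C i j ≠ 0

/-- The datum `(C_{i,j})_{i,j ∈ J}` of the semisimple Lie algebra `𝔤_J`. -/
def restrict (D : CartanDatum I) (J : Finset I) : CartanDatum J where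
  C := D.C.submatrix Subtype.val Subtype.val
  d := fun j => D.d j

/-- `q_i = q ^ d_i`. -/
def qi (D : CartanDatum I) (q : ℂˣ) (i : I) : ℂˣ := q ^ D.d i

end CartanDatum

/-- A coweight `μ = ∑ i, μ_i ω_i^∨` is given by the integers `μ_i = α_i(μ)`; this is its projection
`res_J(μ)` on the coweight lattice of `𝔤_J`. -/
def resCoweight {I : Type*} (J : Finset I) (μ : I → ℤ) : J → ℤ := fun j => μ j

/-! ### `q`-numbers and the exponential of a formal series -/

noncomputable section

/-- `[m]_x`, for an integer `m`. -/
def qNum (x : ℂ) (m : ℤ) : ℂ := (x ^ m - x ^ (-m)) / (x - x⁻¹)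

/-- `[m]_x!`. -/
def qFactorial (x : ℂ) (m : ℕ) : ℂ := ∏ r ∈ Finset.Icc 1 m, qNum x (r : ℤ)

/-- The `q`-binomial coefficient. -/
def qBinom (x : ℂ) (m p : ℕ) : ℂ := qFactorial x m / (qFactorial x p * qFactorial x (m - p))

/-- The coefficient of `z ^ m` in `exp (S) = ∑ n, S ^ n / n!`, for a formal power series `S` in `z`
without constant term (so that only `n ≤ m` contribute). -/
def expCoeff {A : Type*} [Ring A] [Algebra ℂ A] (S : PowerSeries A) (m : ℕ) : A :=
  ∑ n ∈ Finset.range (m + 1), ((n.factorial : ℂ)⁻¹) • PowerSeries.coeff m (S ^ n)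

/-! ### Shifted quantum affine algebras -/

namespace ShiftedAffine

variable {I : Type*}

/-- The generators: `x ε i r` is `x_{i,r}^ε`, `phi ε i r` is `φ_{i,r}^ε`, `phiInv ε i` is the
inverse of `φ_{i,0}^+` (for `ε = 1`) or of `φ_{i,α_i(μ)}^-` (for `ε = -1`), and `h i m` is
`h_{i,m}`, `m ≠ 0`. -/
inductive Gen (I : Type*) where
  | x (ε : ℤˣ) (i : I) (r : ℤ)
  | phi (ε : ℤˣ) (i : I) (r : ℤ)
  | phiInv (ε : ℤˣ) (i : I)
  | h (i : I) (m : {m : ℤ // m ≠ 0})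

/-- `μ(i,+) = 0` and `μ(i,-) = α_i(μ)`. -/
def shift (μ : I → ℤ) (i : I) (ε : ℤˣ) : ℤ := if ε = 1 then 0 else μ i

/-- The formal series `ε (q_i - q_i⁻¹) ∑_{m > 0} h_{i, ε m} z ^ m` (the variable standing for
`z` if `ε = 1` and for `z⁻¹` if `ε = -1`). -/
def hSeries {A : Type*} [Ring A] [Algebra ℂ A] (c : ℂ) (h : {m : ℤ // m ≠ 0} → A) (ε : ℤˣ) :
    PowerSeries A :=
  PowerSeries.mk fun m : ℕ =>
    if hm : (ε : ℤ) * (m : ℤ) ≠ 0 then (((ε : ℤ) : ℂ) * c) • h ⟨(ε : ℤ) * (m : ℤ), hm⟩ else 0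

/-- The left-hand side of the quantum Serre relation, for `y r = x_{i,r}^ε`, `y' = x_{j,r'}^ε`. -/
def serreSum {A : Type*} [Ring A] [Algebra ℂ A] (qi : ℂ) (p : ℕ) (y : ℤ → A) (y' : A)
    (r : Fin p → ℤ) : A :=
  ∑ π : Equiv.Perm (Fin p), ∑ l ∈ Finset.range (p + 1),
    ((-1 : ℂ) ^ l * qBinom qi p l) •
      (((List.ofFn fun k => y (r (π k))).take l).prod * y' *
        ((List.ofFn fun k => y (r (π k))).drop l).prod)

section Rel

variable (D : CartanDatum I) (q : ℂˣ) (μ : I → ℤ)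

/-- The generator `x_{i,r}^ε` of the free algebra. -/
abbrev gx (ε : ℤˣ) (i : I) (r : ℤ) : FreeAlgebra ℂ (Gen I) := FreeAlgebra.ι ℂ (Gen.x ε i r)

/-- The generator `φ_{i,r}^ε` of the free algebra. -/
abbrev gphi (ε : ℤˣ) (i : I) (r : ℤ) : FreeAlgebra ℂ (Gen I) := FreeAlgebra.ι ℂ (Gen.phi ε i r)

/-- The formal inverse of `φ_{i,0}^+`, resp. of `φ_{i,α_i(μ)}^-`, in the free algebra. -/
abbrev gphiInv (ε : ℤˣ) (i : I) : FreeAlgebra ℂ (Gen I) := FreeAlgebra.ι ℂ (Gen.phiInv ε i)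

/-- The generator `h_{i,m}` of the free algebra. -/
abbrev gh (i : I) (m : {m : ℤ // m ≠ 0}) : FreeAlgebra ℂ (Gen I) := FreeAlgebra.ι ℂ (Gen.h i m)

/-- The defining relations. In the relations involving signs, `ε = 1` and `ε = -1` stand for
`+` and `-`. -/
inductive Rel : FreeAlgebra ℂ (Gen I) → FreeAlgebra ℂ (Gen I) → Prop
  | phi_comm (ε ε' : ℤˣ) (i j : I) (r s : ℤ) :
      Rel (gphi ε i r * gphi ε' j s) (gphi ε' j s * gphi ε i r)
  | phi_mul_inv (ε : ℤˣ) (i : I) :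
      Rel (gphi ε i (shift μ i ε) * gphiInv ε i) 1
  | inv_mul_phi (ε : ℤˣ) (i : I) :
      Rel (gphiInv ε i * gphi ε i (shift μ i ε)) 1
  | phi_x (ε ε' : ℤˣ) (i j : I) (r : ℤ) :
      Rel (gphi ε i (shift μ i ε) * gx ε' j r)
        (((D.qi q i : ℂ) ^ ((ε : ℤ) * (ε' : ℤ) * D.C i j)) •
          (gx ε' j r * gphi ε i (shift μ i ε)))
  | h_x (ε : ℤˣ) (i j : I) (m : {m : ℤ // m ≠ 0}) (r : ℤ) :
      Rel (gh i m * gx ε j r - gx ε j r * gh i m)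
        ((((ε : ℤ) : ℂ) * (1 / ((m : ℤ) : ℂ)) * qNum (D.qi q i : ℂ) ((m : ℤ) * D.C i j)) •
          gx ε j ((m : ℤ) + r))
  | xp_xm_same (i : I) (r s : ℤ) :
      Rel (((D.qi q i : ℂ) - (D.qi q i : ℂ)⁻¹) •
          (gx 1 i r * gx (-1) i s - gx (-1) i s * gx 1 i r))
        (gphi 1 i (r + s) - gphi (-1) i (r + s))
  | xp_xm_ne (i j : I) (r s : ℤ) (hij : i ≠ j) :
      Rel (((D.qi q i : ℂ) - (D.qi q i : ℂ)⁻¹) •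
          (gx 1 i r * gx (-1) j s - gx (-1) j s * gx 1 i r)) 0
  | x_x (ε : ℤˣ) (i j : I) (r s : ℤ) :
      Rel (gx ε i (r + 1) * gx ε j s -
          ((D.qi q i : ℂ) ^ ((ε : ℤ) * D.C i j)) • (gx ε j s * gx ε i (r + 1)))
        (((D.qi q i : ℂ) ^ ((ε : ℤ) * D.C i j)) • (gx ε i r * gx ε j (s + 1)) -
          gx ε j (s + 1) * gx ε i r)
  | serre (ε : ℤˣ) (i j : I) (hij : i ≠ j) (r' : ℤ) (r : Fin (1 - D.C i j).toNat → ℤ) :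
      Rel (serreSum (D.qi q i : ℂ) (1 - D.C i j).toNat (gx ε i) (gx ε j r') r) 0
  | phi_zero (ε : ℤˣ) (i : I) (m : ℕ) (hm : 0 < m) :
      Rel (gphi ε i (shift μ i ε - (ε : ℤ) * (m : ℤ))) 0
  | phi_exp (ε : ℤˣ) (i : I) (m : ℕ) :
      Rel (gphi ε i (shift μ i ε + (ε : ℤ) * (m : ℤ)))
        (gphi ε i (shift μ i ε) *
          expCoeff (hSeries ((D.qi q i : ℂ) - (D.qi q i : ℂ)⁻¹) (gh i) ε) m)

end Rel

/-- The shifted quantum affine algebra `U_q^μ(𝔤)`. -/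
abbrev Uq (D : CartanDatum I) (q : ℂˣ) (μ : I → ℤ) : Type _ := RingQuot (Rel D q μ)

variable (D : CartanDatum I) (q : ℂˣ) (μ : I → ℤ)

/-- The canonical projection of the free algebra. -/
def Uq.mk : FreeAlgebra ℂ (Gen I) →ₐ[ℂ] Uq D q μ := RingQuot.mkAlgHom ℂ (Rel D q μ)

/-- The element `x_{i,r}^ε` of `U_q^μ(𝔤)`. -/
def Uq.x (ε : ℤˣ) (i : I) (r : ℤ) : Uq D q μ := Uq.mk D q μ (FreeAlgebra.ι ℂ (Gen.x ε i r))

/-- The element `φ_{i,r}^ε` of `U_q^μ(𝔤)`. -/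
def Uq.phi (ε : ℤˣ) (i : I) (r : ℤ) : Uq D q μ := Uq.mk D q μ (FreeAlgebra.ι ℂ (Gen.phi ε i r))

/-! ### The morphism `U_q^ν(𝔤_J) → U_q^μ(𝔤)` and restriction -/

/-- The identification of generators. -/
def genIncl (J : Finset I) : Gen J → Gen I
  | .x ε j r => .x ε j r
  | .phi ε j r => .phi ε j r
  | .phiInv ε j => .phiInv ε j
  | .h j m => .h j m

/-- The morphism of free algebras identifying generators. -/
def freeIncl (J : Finset I) : FreeAlgebra ℂ (Gen J) →ₐ[ℂ] FreeAlgebra ℂ (Gen I) :=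
  FreeAlgebra.lift ℂ fun g => FreeAlgebra.ι ℂ (genIncl J g)

@[simp] lemma freeIncl_ι (J : Finset I) (g : Gen J) :
    freeIncl J (FreeAlgebra.ι ℂ g) = FreeAlgebra.ι ℂ (genIncl J g) := by
  simp [freeIncl]

lemma map_expCoeff {A B : Type*} [Ring A] [Algebra ℂ A] [Ring B] [Algebra ℂ B] (f : A →ₐ[ℂ] B)
    (S : PowerSeries A) (m : ℕ) :
    f (expCoeff S m) = expCoeff (PowerSeries.map (f : A →+* B) S) m := by
  simp only [expCoeff, map_sum, map_smul, ← map_pow, PowerSeries.coeff_map]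
  rfl

lemma map_hSeries {A B : Type*} [Ring A] [Algebra ℂ A] [Ring B] [Algebra ℂ B] (f : A →ₐ[ℂ] B)
    (c : ℂ) (h : {m : ℤ // m ≠ 0} → A) (ε : ℤˣ) :
    PowerSeries.map (f : A →+* B) (hSeries c h ε) = hSeries c (fun m => f (h m)) ε := by
  ext m
  simp only [hSeries, PowerSeries.coeff_map, PowerSeries.coeff_mk]
  split_ifs
  · exact map_smul f _ _
  · exact map_zero f

lemma map_serreSum {A B : Type*} [Ring A] [Algebra ℂ A] [Ring B] [Algebra ℂ B] (f : A →ₐ[ℂ] B)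
    (qi : ℂ) (p : ℕ) (y : ℤ → A) (y' : A) (r : Fin p → ℤ) :
    f (serreSum qi p y y' r) = serreSum qi p (fun k => f (y k)) (f y') r := by
  simp only [serreSum, map_sum, map_smul, map_mul, map_list_prod, List.map_take, List.map_drop,
    List.map_ofFn]
  rfl

set_option linter.unusedSimpArgs false in
lemma freeIncl_rel (J : Finset I) {a b : FreeAlgebra ℂ (Gen J)}
    (hab : Rel (D.restrict J) q (resCoweight J μ) a b) :
    Rel D q μ (freeIncl J a) (freeIncl J b) := by
  cases hab with
  | phi_comm ε ε' i j r s =>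
    simp only [map_mul, gx, gphi, gphiInv, gh, freeIncl_ι, genIncl]
    exact Rel.phi_comm ε ε' (i : I) (j : I) r s
  | phi_mul_inv ε i =>
    simp only [map_mul, map_one, gx, gphi, gphiInv, gh, freeIncl_ι, genIncl]
    exact Rel.phi_mul_inv ε (i : I)
  | inv_mul_phi ε i =>
    simp only [map_mul, map_one, gx, gphi, gphiInv, gh, freeIncl_ι, genIncl]
    exact Rel.inv_mul_phi ε (i : I)
  | phi_x ε ε' i j r =>
    simp only [map_mul, map_smul, gx, gphi, gphiInv, gh, freeIncl_ι, genIncl]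
    exact Rel.phi_x ε ε' (i : I) (j : I) r
  | h_x ε i j m r =>
    simp only [map_mul, map_smul, map_sub, gx, gphi, gphiInv, gh, freeIncl_ι, genIncl]
    exact Rel.h_x ε (i : I) (j : I) m r
  | xp_xm_same i r s =>
    simp only [map_mul, map_smul, map_sub, gx, gphi, gphiInv, gh, freeIncl_ι, genIncl]
    exact Rel.xp_xm_same (i : I) r s
  | xp_xm_ne i j r s hij =>
    simp only [map_mul, map_smul, map_sub, map_zero, gx, gphi, gphiInv, gh, freeIncl_ι, genIncl]
    exact Rel.xp_xm_ne (i : I) (j : I) r s (fun h => hij (Subtype.ext h))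
  | x_x ε i j r s =>
    simp only [map_mul, map_smul, map_sub, gx, gphi, gphiInv, gh, freeIncl_ι, genIncl]
    exact Rel.x_x ε (i : I) (j : I) r s
  | serre ε i j hij r' r =>
    rw [map_serreSum, map_zero]
    simp only [gx, gphi, gphiInv, gh, freeIncl_ι, genIncl]
    exact Rel.serre ε (i : I) (j : I) (fun h => hij (Subtype.ext h)) r' r
  | phi_zero ε i m hm =>
    simp only [map_zero, gx, gphi, gphiInv, gh, freeIncl_ι, genIncl]
    exact Rel.phi_zero ε (i : I) m hm
  | phi_exp ε i m =>
    rw [map_mul, map_expCoeff, map_hSeries]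
    simp only [gx, gphi, gphiInv, gh, freeIncl_ι, genIncl]
    exact Rel.phi_exp ε (i : I) m

/-- The canonical algebra morphism `ι_J^μ : U_q^ν(𝔤_J) → U_q^μ(𝔤)`, `ν = res_J(μ)`, given by
identifying generators. -/
def incl (J : Finset I) : Uq (D.restrict J) q (resCoweight J μ) →ₐ[ℂ] Uq D q μ :=
  RingQuot.liftAlgHom ℂ ⟨(Uq.mk D q μ).comp (freeIncl J), fun _ _ hab =>
    RingQuot.mkAlgHom_rel ℂ (freeIncl_rel D q μ J hab)⟩

/-- The restriction `res_J^μ(V)` of a `U_q^μ(𝔤)`-module `V` to `U_q^ν(𝔤_J)`, i.e. its pullback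
along `ι_J^μ`. The underlying abelian group is `V`. -/
def Res (_D : CartanDatum I) (_q : ℂˣ) (_μ : I → ℤ) (_J : Finset I) (V : Type*) : Type _ := V

instance (J : Finset I) (V : Type*) [AddCommGroup V] : AddCommGroup (Res D q μ J V) :=
  inferInstanceAs (AddCommGroup V)

instance (J : Finset I) (V : Type*) [AddCommGroup V] [Module (Uq D q μ) V] :
    Module (Uq (D.restrict J) q (resCoweight J μ)) (Res D q μ J V) :=
  Module.compHom V (incl D q μ J).toRingHom

/-! ### The category `𝒪^μ` -/

section CategoryO

variable (V : Type*) [AddCommGroup V] [Module ℂ V] [Module (Uq D q μ) V]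
  [IsScalarTower ℂ (Uq D q μ) V]

/-- The weight space `V_γ^+ = V_γ` (for `ε = 1`) or `V_γ^-` (for `ε = -1`): the space of `v` with
`φ_{i,0}^+ v = γ_i v` for all `i`, resp. `φ_{i,α_i(μ)}^- v = γ_i⁻¹ v` for all `i`. -/
def weightSpace (ε : ℤˣ) (γ : I → ℂˣ) : Submodule ℂ V where
  carrier := {v | ∀ i, Uq.phi D q μ ε i (shift μ i ε) • v = ((γ i ^ (ε : ℤ) : ℂˣ) : ℂ) • v}
  add_mem' := by
    intro a b ha hb i
    rw [smul_add, smul_add, ha i, hb i]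
  zero_mem' := by
    intro i
    rw [smul_zero, smul_zero]
  smul_mem' := by
    intro c v hv i
    rw [← algebraMap_smul (Uq D q μ) c v, ← mul_smul, ← Algebra.commutes, mul_smul, hv i,
      algebraMap_smul, algebraMap_smul, smul_comm]

/-- The partial order on `𝔱^× = (ℂ^×)^I`: `γ ≤ γ'` if `γ' γ⁻¹ = [α]` for some
`α = ∑ j, n_j α_j` with all `n_j ∈ ℕ`, where `[α_j] = (q_i ^ C_{i,j})_i`. -/
def WeightLE [Fintype I] (γ γ' : I → ℂˣ) : Prop :=
  ∃ n : I → ℕ, ∀ i, γ' i = γ i * D.qi q i ^ (∑ j, (n j : ℤ) * D.C i j)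

/-- `V` is an object of the category `𝒪^μ`. -/
structure InCategoryO [Fintype I] : Prop where
  independent : ∀ ε : ℤˣ, iSupIndep (weightSpace D q μ V ε)
  spanning : ∀ ε : ℤˣ, ⨆ γ, weightSpace D q μ V ε γ = ⊤
  finite : ∀ (ε : ℤˣ) (γ : I → ℂˣ), FiniteDimensional ℂ (weightSpace D q μ V ε γ)
  bounded : ∃ L : Finset (I → ℂˣ), ∀ (ε : ℤˣ) (γ : I → ℂˣ), weightSpace D q μ V ε γ ≠ ⊥ →
    ∃ l ∈ L, WeightLE D q γ l

/-- The coefficient of `z ^ r` in the expansion at `z = 0` (for `ε = 1`) or at `z = ∞`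
(for `ε = -1`) of a rational function `f`, computed in the field of Laurent series in `w = z ^ ε`:
`f` is evaluated at `z = w ^ ε` and the coefficient of `w ^ (ε r)` is taken. -/
def ratCoeff (ε : ℤˣ) (f : RatFunc ℂ) (r : ℤ) : ℂ :=
  (RatFunc.eval HahnSeries.C (HahnSeries.single (ε : ℤ) (1 : ℂ)) f : LaurentSeries ℂ).coeff
    ((ε : ℤ) * r)

/-- The set `𝔯` of tuples of rational functions regular and non-zero at `z = 0`. -/
def lWeights (I : Type*) : Set (I → RatFunc ℂ) :=
  {Ψ | ∀ i, (Ψ i).denom.eval 0 ≠ 0 ∧ (Ψ i).num.eval 0 ≠ 0}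

/-- `V` is an object of `𝒪^μ` of highest `ℓ`-weight `Ψ`. -/
def HasHighestLWeight [Fintype I] (Ψ : I → RatFunc ℂ) : Prop :=
  InCategoryO D q μ V ∧ ∃ v : V, v ≠ 0 ∧
    Submodule.span (Uq D q μ) {v} = ⊤ ∧
    (∀ i r, Uq.x D q μ 1 i r • v = 0) ∧
    (∀ ε i r, Uq.phi D q μ ε i r • v = ratCoeff ε (Ψ i) r • v)

/-- `V` is a highest `ℓ`-weight module. -/
def IsHighestLWeightModule [Fintype I] : Prop :=
  ∃ Ψ ∈ lWeights I, HasHighestLWeight D q μ V Ψ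

end CategoryO

/-! ### Inflations, radical and head -/

/-- `V` is a `J`-inflation of `W` to `𝔤` with coweight `μ`. -/
structure IsInflation [Fintype I] (J : Finset I)
    (W : Type*) [AddCommGroup W] [Module ℂ W] [Module (Uq (D.restrict J) q (resCoweight J μ)) W]
    [IsScalarTower ℂ (Uq (D.restrict J) q (resCoweight J μ)) W]
    (V : Type*) [AddCommGroup V] [Module ℂ V] [Module (Uq D q μ) V]
    [IsScalarTower ℂ (Uq D q μ) V] : Prop where
  source_mem : InCategoryO (D.restrict J) q (resCoweight J μ) W
  target_mem : InCategoryO D q μ V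
  res_iso : Nonempty (Res D q μ J V ≃ₗ[Uq (D.restrict J) q (resCoweight J μ)] W)
  x_smul_eq_zero : ∀ i ∉ J, ∀ (ε : ℤˣ) (r : ℤ) (v : V), Uq.x D q μ ε i r • v = 0

/-- The Jacobson radical of a module: the intersection of its maximal proper submodules. -/
abbrev rad (A : Type*) [Ring A] (M : Type*) [AddCommGroup M] [Module A M] : Submodule A M :=
  Module.jacobson A M

/-- The head of a module: its quotient by the Jacobson radical. -/
abbrev Head (A : Type*) [Ring A] (M : Type*) [AddCommGroup M] [Module A M] : Type _ :=
  M ⧸ rad A M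

end ShiftedAffine

end

open ShiftedAffine

/-!
Let `U = U_q^μ(𝔤)` and `U_J = U_q^ν(𝔤_J)`, and identify `V` with `W` through the given isomorphism.
It is enough to see that `rad V` and `rad W` are the same subspace (`resEquiv_mem_rad_iff`), because
submodules and quotients of objects of `𝒪^μ` are again in `𝒪^μ` (`InCategoryO.submodule`,
`InCategoryO.quotient`) and the `x_{i,r}^±`, `i ∉ J`, still act by zero on them.

*The radical of `W`.* Moving generators past the `x_{j,r}^-` shows that `W` is spanned by the vectors
`x_{j₁,r₁}^- ⋯ x_{jₖ,rₖ}^- w`, where `w` is the highest weight vector (`span_lowering_eq_top`). As `q`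
is not a root of unity and the symmetrized Cartan matrix is positive definite, all those with `k > 0`
have weights different from the weight `γ₀` of `w`. A submodule contains the weight components of its
elements, so a proper submodule has no component of weight `γ₀` (`exists_highest_weight`). Hence `W`
has a largest proper submodule `N₀`, which is `rad W`.

*The radical of `V`.* Every `U`-submodule of `V` is a `U_J`-submodule, so what remains is that `N₀` is
stable under `U`, that is, under the Cartan generators `t` of nodes `i ∉ J`. These need not commute
with `U_J`, but for `a ∈ U_J` there are `b, c ∈ U_J` with `a t = t b + c` (`skewCommutant_eq_top`).
Thus `U_J t N₀ ⊆ t N₀ + N₀`. Since `t` commutes with the `φ_{j,0}^+`, it preserves weights, so this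
subspace has no component of weight `γ₀`; therefore `U_J t N₀` is a proper submodule and is contained
in `N₀` (`cartan_smul_mem`).

For `t = h_{i,m}` the commutation with the `φ_{j,r}^±` is not a defining relation. It follows from the
fact that the exponential of a series can be inverted inside any subalgebra
(`coeff_mem_of_expCoeff_mem`), so that `h_{i,m}` is a polynomial in the `φ_{i,r}^±` and the inverses
of the invertible ones.
-/

namespace ShiftedAffine

/-! ### Exponentials of formal series and subalgebras -/

section Exponential

variable {A : Type*} [Ring A] [Algebra ℂ A] (B : Subalgebra ℂ A)

lemma coeff_pow_mem {S : PowerSeries A} {k : ℕ} (hS : ∀ j < k, PowerSeries.coeff j S ∈ B)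
    (n : ℕ) : ∀ i < k, PowerSeries.coeff i (S ^ n) ∈ B := by
  induction n with
  | zero =>
    intro i _
    rw [pow_zero, PowerSeries.coeff_one]
    split_ifs
    exacts [B.one_mem, B.zero_mem]
  | succ n ih =>
    intro i hi
    rw [pow_succ, PowerSeries.coeff_mul]
    refine B.sum_mem fun p hp => ?_
    have := Finset.HasAntidiagonal.mem_antidiagonal.1 hp
    exact B.mul_mem (ih _ (by omega)) (hS _ (by omega))

lemma expCoeff_mem {S : PowerSeries A} (hS : ∀ j, PowerSeries.coeff j S ∈ B) (m : ℕ) :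
    expCoeff S m ∈ B :=
  B.sum_mem fun n _ => B.smul_mem
    (coeff_pow_mem B (k := m + 1) (fun j _ => hS j) n m (Nat.lt_succ_self m)) _

/-- A series without constant term is recovered from its exponential: the coefficient of `z ^ k`
in `exp S` is that of `S` plus a polynomial in the earlier coefficients of `S`. -/
lemma coeff_mem_of_expCoeff_mem {S : PowerSeries A} (h0 : PowerSeries.coeff 0 S = 0)
    (hS : ∀ m, expCoeff S m ∈ B) (k : ℕ) : PowerSeries.coeff k S ∈ B := by
  induction k using Nat.strong_induction_on with
  | _ k ih =>
    rcases Nat.eq_zero_or_pos k with rfl | hk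
    · rw [h0]; exact B.zero_mem
    obtain ⟨k, rfl⟩ : ∃ l, k = l + 1 := ⟨k - 1, by omega⟩
    have hpow0 : ∀ n, PowerSeries.coeff 0 (S ^ (n + 1)) = 0 := fun n => by
      rw [pow_succ, PowerSeries.coeff_mul]
      simp [h0]
    have hmem : ∀ n, PowerSeries.coeff (k + 1) (S ^ (n + 2)) ∈ B := fun n => by
      rw [pow_succ, PowerSeries.coeff_mul]
      refine B.sum_mem fun p hp => ?_
      have hp' := Finset.HasAntidiagonal.mem_antidiagonal.1 hp
      by_cases h1 : p.1 = 0
      · rw [h1, hpow0, zero_mul]; exact B.zero_mem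
      by_cases h2 : p.2 = 0
      · rw [h2, h0, mul_zero]; exact B.zero_mem
      exact B.mul_mem (coeff_pow_mem B ih _ _ (by omega)) (ih _ (by omega))
    have hsum := hS (k + 1)
    rw [expCoeff, Finset.sum_range_succ', Finset.sum_range_succ'] at hsum
    have h1 : PowerSeries.coeff (k + 1) (S ^ 0) = 0 := by
      rw [pow_zero, PowerSeries.coeff_one, if_neg (Nat.succ_ne_zero k)]
    simp only [h1, smul_zero, add_zero, zero_add, pow_one, Nat.factorial_one, Nat.cast_one,
      inv_one, one_smul] at hsum
    exact (add_mem_cancel_left (B.sum_mem fun n _ => B.smul_mem (hmem n) _)).1 hsum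

end Exponential

/-! ### Generators and relations -/

section Relations

variable {I : Type*} (D : CartanDatum I) (q : ℂˣ) (μ : I → ℤ)

/-- The image in `U_q^μ(𝔤)` of a generator. -/
noncomputable def Uq.gen (g : Gen I) : Uq D q μ := Uq.mk D q μ (FreeAlgebra.ι ℂ g)

lemma Uq.mk_rel {a b : FreeAlgebra ℂ (Gen I)} (hab : Rel D q μ a b) :
    Uq.mk D q μ a = Uq.mk D q μ b :=
  RingQuot.mkAlgHom_rel ℂ hab

lemma Uq.x_eq_gen (ε : ℤˣ) (i : I) (r : ℤ) : Uq.x D q μ ε i r = Uq.gen D q μ (.x ε i r) := rfl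

lemma Uq.phi_eq_gen (ε : ℤˣ) (i : I) (r : ℤ) :
    Uq.phi D q μ ε i r = Uq.gen D q μ (.phi ε i r) := rfl

lemma Uq.subalgebra_eq_top (B : Subalgebra ℂ (Uq D q μ)) (hB : ∀ g, Uq.gen D q μ g ∈ B) :
    B = ⊤ := by
  refine top_unique fun a _ => ?_
  obtain ⟨a, rfl⟩ := RingQuot.mkAlgHom_surjective ℂ (Rel D q μ) a
  have h : B.comap (Uq.mk D q μ) = ⊤ := by
    rw [← top_le_iff, ← FreeAlgebra.adjoin_range_ι, Algebra.adjoin_le_iff]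
    rintro _ ⟨g, rfl⟩
    exact hB g
  exact (h ▸ Algebra.mem_top : a ∈ B.comap (Uq.mk D q μ))

lemma Uq.phi_comm (ε ε' : ℤˣ) (i j : I) (r s : ℤ) :
    Uq.phi D q μ ε i r * Uq.phi D q μ ε' j s = Uq.phi D q μ ε' j s * Uq.phi D q μ ε i r := by
  have h := Uq.mk_rel D q μ (Rel.phi_comm ε ε' i j r s)
  rw [map_mul, map_mul] at h
  exact h

lemma Uq.phi_mul_inv (ε : ℤˣ) (i : I) :
    Uq.phi D q μ ε i (shift μ i ε) * Uq.gen D q μ (.phiInv ε i) = 1 := by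
  have h := Uq.mk_rel D q μ (Rel.phi_mul_inv ε i)
  rw [map_mul, map_one] at h
  exact h

lemma Uq.inv_mul_phi (ε : ℤˣ) (i : I) :
    Uq.gen D q μ (.phiInv ε i) * Uq.phi D q μ ε i (shift μ i ε) = 1 := by
  have h := Uq.mk_rel D q μ (Rel.inv_mul_phi ε i)
  rw [map_mul, map_one] at h
  exact h

lemma Uq.phi_mul_x (ε ε' : ℤˣ) (i j : I) (r : ℤ) :
    Uq.phi D q μ ε i (shift μ i ε) * Uq.x D q μ ε' j r =
      ((D.qi q i : ℂ) ^ ((ε : ℤ) * (ε' : ℤ) * D.C i j)) •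
        (Uq.x D q μ ε' j r * Uq.phi D q μ ε i (shift μ i ε)) := by
  have h := Uq.mk_rel D q μ (Rel.phi_x ε ε' i j r)
  rw [map_smul, map_mul, map_mul] at h
  exact h

lemma Uq.phiInv_mul_x (ε ε' : ℤˣ) (i j : I) (r : ℤ) :
    Uq.gen D q μ (.phiInv ε i) * Uq.x D q μ ε' j r =
      ((D.qi q i : ℂ) ^ ((ε : ℤ) * (ε' : ℤ) * D.C i j))⁻¹ •
        (Uq.x D q μ ε' j r * Uq.gen D q μ (.phiInv ε i)) := by
  have hc : ((D.qi q i : ℂ) ^ ((ε : ℤ) * (ε' : ℤ) * D.C i j)) ≠ 0 := zpow_ne_zero _ (Units.ne_zero _)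
  rw [eq_inv_smul_iff₀ hc]
  calc _ = Uq.gen D q μ (.phiInv ε i) * ((D.qi q i : ℂ) ^ ((ε : ℤ) * (ε' : ℤ) * D.C i j) •
        (Uq.x D q μ ε' j r * Uq.phi D q μ ε i (shift μ i ε))) * Uq.gen D q μ (.phiInv ε i) := by
        rw [mul_smul_comm, smul_mul_assoc, ← mul_assoc (Uq.gen D q μ _),
          mul_assoc _ (Uq.phi D q μ _ _ _), Uq.phi_mul_inv, mul_one]
    _ = _ := by
        rw [← Uq.phi_mul_x, ← mul_assoc, Uq.inv_mul_phi, one_mul]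

lemma Uq.h_mul_x (ε : ℤˣ) (i j : I) (m : {m : ℤ // m ≠ 0}) (r : ℤ) :
    Uq.gen D q μ (.h i m) * Uq.x D q μ ε j r =
      Uq.x D q μ ε j r * Uq.gen D q μ (.h i m) +
      (((ε : ℤ) : ℂ) * (1 / ((m : ℤ) : ℂ)) * qNum (D.qi q i : ℂ) ((m : ℤ) * D.C i j)) •
        Uq.x D q μ ε j ((m : ℤ) + r) := by
  have h := Uq.mk_rel D q μ (Rel.h_x ε i j m r)
  rw [map_sub, map_mul, map_mul, map_smul, sub_eq_iff_eq_add'] at h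
  exact h

lemma Uq.phi_zero (ε : ℤˣ) (i : I) (m : ℕ) (hm : 0 < m) :
    Uq.phi D q μ ε i (shift μ i ε - (ε : ℤ) * (m : ℤ)) = 0 := by
  have h := Uq.mk_rel D q μ (Rel.phi_zero ε i m hm)
  rw [map_zero] at h
  exact h

lemma Uq.phi_exp (ε : ℤˣ) (i : I) (m : ℕ) :
    Uq.phi D q μ ε i (shift μ i ε + (ε : ℤ) * (m : ℤ)) =
      Uq.phi D q μ ε i (shift μ i ε) *
        expCoeff (hSeries ((D.qi q i : ℂ) - (D.qi q i : ℂ)⁻¹)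
          (fun k => Uq.gen D q μ (.h i k)) ε) m := by
  have h := Uq.mk_rel D q μ (Rel.phi_exp ε i m)
  rw [map_mul, map_expCoeff, map_hSeries] at h
  exact h

variable {D q}

/-- `q_i - q_i⁻¹ ≠ 0`, since `q` is not a root of unity. -/
lemma qi_sub_inv_ne_zero (hq : ∀ n : ℕ, 0 < n → q ^ n ≠ 1) {i : I} (hd : 0 < D.d i) :
    (D.qi q i : ℂ) - (D.qi q i : ℂ)⁻¹ ≠ 0 := by
  intro h
  refine hq (D.d i * 2) (by omega) (Units.ext ?_)
  have h1 : (D.qi q i : ℂ) * (D.qi q i : ℂ) = 1 := by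
    nth_rewrite 2 [sub_eq_zero.1 h]
    exact mul_inv_cancel₀ (Units.ne_zero _)
  rw [pow_mul, pow_two]
  exact h1

/-- The product `x_{i,r}^+ x_{j,s}^-` is `x_{j,s}^- x_{i,r}^+` up to a multiple of
`φ_{i,r+s}^+ - φ_{i,r+s}^-`. -/
lemma Uq.xp_mul_xm {i : I} (hi : (D.qi q i : ℂ) - (D.qi q i : ℂ)⁻¹ ≠ 0) (j : I) (r s : ℤ) :
    ∃ c : ℂ, Uq.x D q μ 1 i r * Uq.x D q μ (-1) j s =
      Uq.x D q μ (-1) j s * Uq.x D q μ 1 i r +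
        c • (Uq.phi D q μ 1 i (r + s) - Uq.phi D q μ (-1) i (r + s)) := by
  by_cases hij : i = j
  · subst hij
    have h := Uq.mk_rel D q μ (Rel.xp_xm_same i r s)
    rw [map_smul, map_sub, map_mul, map_mul, ← eq_inv_smul_iff₀ hi, map_sub,
      sub_eq_iff_eq_add'] at h
    exact ⟨_, h⟩
  · have h := Uq.mk_rel D q μ (Rel.xp_xm_ne i j r s hij)
    rw [map_smul, map_sub, map_mul, map_mul, map_zero, smul_eq_zero_iff_right hi,
      sub_eq_zero] at h
    exact ⟨0, by rw [zero_smul, add_zero]; exact h⟩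

/-- By the defining formula for the `h_{i,m}`, a subalgebra containing them and `φ_{i,0}^+`,
`φ_{i,α_i(μ)}^-` contains all `φ_{i,r}^±`. -/
lemma Uq.phi_mem {B : Subalgebra ℂ (Uq D q μ)} {i : I}
    (hphi : ∀ ε, Uq.phi D q μ ε i (shift μ i ε) ∈ B)
    (hh : ∀ m, Uq.gen D q μ (.h i m) ∈ B) (ε : ℤˣ) (r : ℤ) : Uq.phi D q μ ε i r ∈ B := by
  have hup : ∀ m : ℕ, Uq.phi D q μ ε i (shift μ i ε + (ε : ℤ) * (m : ℤ)) ∈ B := fun m => by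
    rw [Uq.phi_exp]
    refine B.mul_mem (hphi ε) (expCoeff_mem B (fun j => ?_) m)
    rw [hSeries, PowerSeries.coeff_mk]
    split_ifs
    exacts [B.smul_mem (hh _) _, B.zero_mem]
  have hdown : ∀ m : ℕ, Uq.phi D q μ ε i (shift μ i ε - (ε : ℤ) * (m : ℤ)) ∈ B := fun m => by
    rcases Nat.eq_zero_or_pos m with rfl | hm
    · simpa using hphi ε
    · rw [Uq.phi_zero D q μ ε i m hm]; exact B.zero_mem
  have hε : (ε : ℤ) * (ε : ℤ) = 1 := by rcases Int.units_eq_one_or ε with rfl | rfl <;> rfl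
  obtain ⟨m, hm | hm⟩ := Int.eq_nat_or_neg ((ε : ℤ) * (r - shift μ i ε))
  · have := hup m
    rwa [← hm, ← mul_assoc, hε, one_mul, add_sub_cancel] at this
  · have := hdown m
    rwa [← neg_eq_iff_eq_neg.2 hm, mul_neg, ← mul_assoc, hε, one_mul, sub_neg_eq_add,
      add_sub_cancel] at this

/-- Since `q_i - q_i⁻¹ ≠ 0`, the elements `h_{i,m}` are polynomials in the `φ_{i,r}^±` and the
inverses of the invertible ones among them. -/
lemma Uq.h_mem {B : Subalgebra ℂ (Uq D q μ)} {i : I}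
    (hi : (D.qi q i : ℂ) - (D.qi q i : ℂ)⁻¹ ≠ 0)
    (hphi : ∀ ε r, Uq.phi D q μ ε i r ∈ B) (hinv : ∀ ε, Uq.gen D q μ (.phiInv ε i) ∈ B)
    (m : {m : ℤ // m ≠ 0}) : Uq.gen D q μ (.h i m) ∈ B := by
  have key : ∀ (ε : ℤˣ) (k : ℕ) (hk : (ε : ℤ) * (k : ℤ) ≠ 0),
      Uq.gen D q μ (.h i ⟨(ε : ℤ) * (k : ℤ), hk⟩) ∈ B := fun ε k hk => by
    have h := coeff_mem_of_expCoeff_mem B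
      (S := hSeries ((D.qi q i : ℂ) - (D.qi q i : ℂ)⁻¹) (fun k => Uq.gen D q μ (.h i k)) ε)
      (by simp [hSeries]) (fun m => ?_) k
    · rw [hSeries, PowerSeries.coeff_mk, dif_pos hk] at h
      have hc : (((ε : ℤ) : ℂ) * ((D.qi q i : ℂ) - (D.qi q i : ℂ)⁻¹)) ≠ 0 :=
        mul_ne_zero (Int.cast_ne_zero.2 (Units.ne_zero ε)) hi
      have h' := B.smul_mem h (((ε : ℤ) : ℂ) * ((D.qi q i : ℂ) - (D.qi q i : ℂ)⁻¹))⁻¹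
      rwa [inv_smul_smul₀ hc] at h'
    · have h := B.mul_mem (hinv ε) (hphi ε (shift μ i ε + (ε : ℤ) * (m : ℤ)))
      rwa [Uq.phi_exp, ← mul_assoc, Uq.inv_mul_phi, one_mul] at h
  obtain ⟨m, hm⟩ := m
  obtain ⟨k, rfl | rfl⟩ := Int.eq_nat_or_neg m
  · simpa using key 1 k (by simpa using hm)
  · simpa using key (-1) k (by simpa using hm)

lemma Uq.phiInv_mem_centralizer {a : Uq D q μ} {ε : ℤˣ} {i : I}
    (h : Uq.phi D q μ ε i (shift μ i ε) ∈ Subalgebra.centralizer ℂ {a}) :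
    Uq.gen D q μ (.phiInv ε i) ∈ Subalgebra.centralizer ℂ {a} := by
  rw [Subalgebra.mem_centralizer_iff] at h ⊢
  rintro _ rfl
  have h := h _ rfl
  calc _ = Uq.gen D q μ (.phiInv ε i) * (Uq.phi D q μ ε i (shift μ i ε) * _) *
        Uq.gen D q μ (.phiInv ε i) := by
        rw [← mul_assoc, Uq.inv_mul_phi, one_mul]
    _ = _ := by
        rw [← h, mul_assoc, mul_assoc, Uq.phi_mul_inv, mul_one]

/-- The generators of the Cartan part: all except the `x_{i,r}^±`. -/
def Gen.IsCartan : Gen I → Prop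
  | .x _ _ _ => False
  | _ => True

lemma Uq.cartan_mem_centralizer (hD : ∀ i, (D.qi q i : ℂ) - (D.qi q i : ℂ)⁻¹ ≠ 0)
    {a : Uq D q μ} (h : ∀ ε i r, Uq.phi D q μ ε i r ∈ Subalgebra.centralizer ℂ {a})
    {g : Gen I} (hg : g.IsCartan) : Uq.gen D q μ g ∈ Subalgebra.centralizer ℂ {a} := by
  cases g with
  | x => exact hg.elim
  | phi ε i r => exact h ε i r
  | phiInv ε i => exact Uq.phiInv_mem_centralizer μ (h ε i _)
  | h i m =>
    exact Uq.h_mem μ (hD i) (fun ε r => h ε i r)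
      (fun ε => Uq.phiInv_mem_centralizer μ (h ε i _)) m

/-- The generators of the Cartan part commute. -/
lemma Uq.cartan_commute (hD : ∀ i, (D.qi q i : ℂ) - (D.qi q i : ℂ)⁻¹ ≠ 0)
    {g g' : Gen I} (hg : g.IsCartan) (hg' : g'.IsCartan) :
    Commute (Uq.gen D q μ g) (Uq.gen D q μ g') := by
  have h1 : ∀ ε i r, Commute (Uq.gen D q μ g) (Uq.phi D q μ ε i r) := fun ε i r =>
    (Subalgebra.mem_centralizer_iff ℂ |>.1 (Uq.cartan_mem_centralizer μ hD
      (a := Uq.phi D q μ ε i r) (fun ε' j s => Subalgebra.mem_centralizer_iff ℂ |>.2 (by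
        rintro _ rfl; exact Uq.phi_comm D q μ ε ε' i j r s)) hg) _ rfl).symm
  exact (Subalgebra.mem_centralizer_iff ℂ |>.1 (Uq.cartan_mem_centralizer μ hD
      (a := Uq.gen D q μ g) (fun ε' j s => Subalgebra.mem_centralizer_iff ℂ |>.2 (by
        rintro _ rfl; exact h1 ε' j s)) hg') _ rfl)

end Relations

/-! ### Weight spaces of submodules and quotients -/

section Weights

variable {I : Type*} {D : CartanDatum I} {q : ℂˣ} {μ : I → ℤ}
  {V : Type*} [AddCommGroup V] [Module ℂ V] [Module (Uq D q μ) V] [IsScalarTower ℂ (Uq D q μ) V]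

lemma smul_smul_comm (a : Uq D q μ) (c : ℂ) (v : V) : a • c • v = c • a • v := by
  rw [← algebraMap_smul (Uq D q μ) c v, ← mul_smul, ← Algebra.commutes, mul_smul, algebraMap_smul]

lemma mem_weightSpace {ε : ℤˣ} {γ : I → ℂˣ} {v : V} : v ∈ weightSpace D q μ V ε γ ↔
    ∀ i, Uq.phi D q μ ε i (shift μ i ε) • v = ((γ i ^ (ε : ℤ) : ℂˣ) : ℂ) • v := Iff.rfl

/-- A submodule containing a sum of weight vectors of distinct weights contains each of them. -/
lemma weight_components_mem (N : Submodule (Uq D q μ) V) (ε : ℤˣ) (s : Finset (I → ℂˣ)) :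
    ∀ v : (I → ℂˣ) → V, (∀ γ ∈ s, v γ ∈ weightSpace D q μ V ε γ) → ∑ γ ∈ s, v γ ∈ N →
      ∀ γ ∈ s, v γ ∈ N := by
  classical
  induction s using Finset.induction_on with
  | empty => simp
  | insert γ₀ s hγ₀ ih =>
    intro v hv hsum
    have hs : ∀ γ ∈ s, v γ ∈ N := by
      intro γ hγ
      obtain ⟨i, hi⟩ := Function.ne_iff.1 (ne_of_mem_of_not_mem hγ hγ₀)
      -- the operator `φ_i - γ₀_i` kills the component of weight `γ₀`
      have hmem : ∑ γ' ∈ s, (((γ' i ^ (ε : ℤ) : ℂˣ) : ℂ) - 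
          ((γ₀ i ^ (ε : ℤ) : ℂˣ) : ℂ)) • v γ' ∈ N := by
        have h := N.sub_mem (N.smul_mem (Uq.phi D q μ ε i (shift μ i ε)) hsum)
          (N.smul_of_tower_mem ((γ₀ i ^ (ε : ℤ) : ℂˣ) : ℂ) hsum)
        rw [Finset.smul_sum, Finset.smul_sum, ← Finset.sum_sub_distrib,
          Finset.sum_insert hγ₀, mem_weightSpace.1 (hv γ₀ (Finset.mem_insert_self _ _)) i, sub_self,
          zero_add] at h
        convert h using 1
        refine Finset.sum_congr rfl fun γ' hγ' => ?_
        rw [sub_smul, mem_weightSpace.1 (hv γ' (Finset.mem_insert_of_mem hγ')) i]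
      have h := ih _ (fun γ' hγ' => Submodule.smul_mem _ _ (hv γ' (Finset.mem_insert_of_mem hγ')))
        hmem γ hγ
      have hne : ((γ i ^ (ε : ℤ) : ℂˣ) : ℂ) - ((γ₀ i ^ (ε : ℤ) : ℂˣ) : ℂ) ≠ 0 := by
        rw [sub_ne_zero, Ne, Units.val_inj]
        rcases Int.units_eq_one_or ε with rfl | rfl <;> simpa using hi
      have h' := N.smul_of_tower_mem (((γ i ^ (ε : ℤ) : ℂˣ) : ℂ) - ((γ₀ i ^ (ε : ℤ) : ℂˣ) : ℂ))⁻¹ h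
      rwa [inv_smul_smul₀ hne] at h'
    intro γ hγ
    rcases Finset.mem_insert.1 hγ with rfl | hγ
    · rw [Finset.sum_insert hγ₀] at hsum
      exact (add_mem_cancel_right (N.sum_mem hs)).1 hsum
    · exact hs γ hγ

lemma iSupIndep_weightSpace (ε : ℤˣ) : iSupIndep (weightSpace D q μ V ε) := by
  rw [iSupIndep_iff_finsetSum_eq_zero_imp_eq_zero]
  intro s v hv hsum γ hγ
  exact (Submodule.mem_bot (Uq D q μ)).1 <|
    weight_components_mem (⊥ : Submodule (Uq D q μ) V) ε s v hv ((Submodule.mem_bot _).2 hsum) γ hγ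

lemma mkQ_mem_weightSpace (N : Submodule (Uq D q μ) V) {ε : ℤˣ} {γ : I → ℂˣ} {v : V}
    (hv : v ∈ weightSpace D q μ V ε γ) : N.mkQ v ∈ weightSpace D q μ (V ⧸ N) ε γ := fun i => by
  rw [← map_smul, hv i]
  rfl

lemma coe_mem_weightSpace {N : Submodule (Uq D q μ) V} {ε : ℤˣ} {γ : I → ℂˣ} {n : N} :
    (n : V) ∈ weightSpace D q μ V ε γ ↔ n ∈ weightSpace D q μ N ε γ :=
  ⟨fun h i => Subtype.ext (h i), fun h i => congrArg Subtype.val (h i)⟩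

/-- In a quotient of a module spanned by weight vectors, every weight vector lifts to a weight
vector of the same weight. -/
lemma exists_weight_lift (hV : ∀ ε : ℤˣ, ⨆ γ, weightSpace D q μ V ε γ = ⊤)
    (N : Submodule (Uq D q μ) V) {ε : ℤˣ} {γ : I → ℂˣ} {u : V ⧸ N}
    (hu : u ∈ weightSpace D q μ (V ⧸ N) ε γ) :
    ∃ v ∈ weightSpace D q μ V ε γ, N.mkQ v = u := by
  classical
  obtain ⟨v, rfl⟩ := N.mkQ_surjective u
  obtain ⟨f, hf, hfv⟩ := (Submodule.mem_iSup_iff_exists_finsupp _ v).1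
    (hV ε ▸ Submodule.mem_top : v ∈ ⨆ γ, weightSpace D q μ V ε γ)
  refine ⟨f γ, hf γ, ?_⟩
  have h := (iSupIndep_iff_finsetSum_eq_zero_imp_eq_zero _).1
    (iSupIndep_weightSpace (D := D) (q := q) (μ := μ) (V := V ⧸ N) ε) (insert γ f.support)
    (fun γ' => N.mkQ (f γ') - if γ' = γ then N.mkQ v else 0) (fun γ' _ => ?_) ?_ γ
    (Finset.mem_insert_self _ _)
  · simpa [sub_eq_zero] using h
  · refine Submodule.sub_mem _ (mkQ_mem_weightSpace N (hf γ')) ?_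
    split_ifs with h
    exacts [h ▸ hu, Submodule.zero_mem _]
  · rw [Finset.sum_sub_distrib, Finset.sum_ite_eq', if_pos (Finset.mem_insert_self _ _), ← map_sum,
      ← hfv, sub_eq_zero, Finsupp.sum_of_support_subset f (Finset.subset_insert γ _) _ (by simp)]

lemma InCategoryO.submodule [Fintype I] (hV : InCategoryO D q μ V) (N : Submodule (Uq D q μ) V) :
    InCategoryO D q μ N where
  independent := iSupIndep_weightSpace
  spanning ε := by
    refine top_unique fun n _ => ?_
    obtain ⟨f, hf, hfn⟩ := (Submodule.mem_iSup_iff_exists_finsupp _ (n : V)).1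
      (hV.spanning ε ▸ Submodule.mem_top : (n : V) ∈ ⨆ γ, weightSpace D q μ V ε γ)
    have hN := weight_components_mem N ε f.support f (fun γ _ => hf γ)
      (by rw [show ∑ γ ∈ f.support, f γ = n from hfn]; exact n.2)
    have hn : n = ∑ γ ∈ f.support.attach, ⟨f γ, hN γ γ.2⟩ := by
      refine Subtype.ext ?_
      rw [AddSubmonoidClass.coe_finsetSum, ← hfn]
      exact (Finset.sum_attach f.support f).symm
    rw [hn]
    exact Submodule.sum_mem _ fun γ _ => Submodule.mem_iSup_of_mem (γ : I → ℂˣ)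
      (coe_mem_weightSpace.1 (hf γ))
  finite ε γ := by
    have := hV.finite ε γ
    refine Module.Finite.of_injective
      ((N.subtype.restrictScalars ℂ).restrict (p := weightSpace D q μ N ε γ)
        (q := weightSpace D q μ V ε γ) fun _ hn => coe_mem_weightSpace.2 hn) fun a b hab => ?_
    have h := congrArg (weightSpace D q μ V ε γ).subtype hab
    exact Subtype.ext (Subtype.ext h)
  bounded := by
    obtain ⟨L, hL⟩ := hV.bounded
    refine ⟨L, fun ε γ hγ => hL ε γ ?_⟩
    obtain ⟨n, hn, hn0⟩ := (Submodule.ne_bot_iff _).1 hγ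
    exact (Submodule.ne_bot_iff _).2 ⟨n, coe_mem_weightSpace.2 hn, by simpa using hn0⟩

lemma InCategoryO.quotient [Fintype I] (hV : InCategoryO D q μ V) (N : Submodule (Uq D q μ) V) :
    InCategoryO D q μ (V ⧸ N) where
  independent := iSupIndep_weightSpace
  spanning ε := by
    refine top_unique fun u _ => ?_
    obtain ⟨v, rfl⟩ := N.mkQ_surjective u
    obtain ⟨f, hf, rfl⟩ := (Submodule.mem_iSup_iff_exists_finsupp _ v).1
      (hV.spanning ε ▸ Submodule.mem_top : v ∈ ⨆ γ, weightSpace D q μ V ε γ)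
    rw [Finsupp.sum, map_sum]
    exact Submodule.sum_mem _ fun γ _ =>
      Submodule.mem_iSup_of_mem γ (mkQ_mem_weightSpace N (hf γ))
  finite ε γ := by
    have := hV.finite ε γ
    refine Submodule.finiteDimensional_of_le
      (S₂ := (weightSpace D q μ V ε γ).map (N.mkQ.restrictScalars ℂ)) fun u hu => ?_
    obtain ⟨v, hv, rfl⟩ := exists_weight_lift hV.spanning N hu
    exact ⟨v, hv, rfl⟩
  bounded := by
    obtain ⟨L, hL⟩ := hV.bounded
    refine ⟨L, fun ε γ hγ => hL ε γ ?_⟩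
    obtain ⟨u, hu, hu0⟩ := (Submodule.ne_bot_iff _).1 hγ
    obtain ⟨v, hv, rfl⟩ := exists_weight_lift hV.spanning N hu
    exact (Submodule.ne_bot_iff _).2 ⟨v, hv, fun h => hu0 (by rw [h, map_zero])⟩

end Weights

/-! ### Highest `ℓ`-weight modules -/

section HighestWeight

variable {I : Type*} {D : CartanDatum I} {q : ℂˣ} {μ : I → ℤ}
  {W : Type*} [AddCommGroup W] [Module ℂ W] [Module (Uq D q μ) W]

variable (D q μ) in
/-- The vector `x_{i₁,r₁}^- ⋯ x_{iₖ,rₖ}^- w` for the list `(i₁,r₁), …, (iₖ,rₖ)`. -/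
noncomputable def lowering (w : W) : List (I × ℤ) → W
  | [] => w
  | a :: l => Uq.x D q μ (-1) a.1 a.2 • lowering w l

lemma lowering_mem_span (w : W) (l : List (I × ℤ)) :
    lowering D q μ w l ∈ Submodule.span ℂ (Set.range (lowering D q μ w)) :=
  Submodule.subset_span ⟨l, rfl⟩

variable [IsScalarTower ℂ (Uq D q μ) W]

variable (D q μ) in
/-- The elements of `U_q^μ(𝔤)` that map the subspace `P` into itself. -/
def stabilizer (P : Submodule ℂ W) : Subalgebra ℂ (Uq D q μ) where
  carrier := {a | ∀ v ∈ P, a • v ∈ P}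
  mul_mem' ha hb v hv := by rw [mul_smul]; exact ha _ (hb v hv)
  add_mem' ha hb v hv := by rw [add_smul]; exact P.add_mem (ha v hv) (hb v hv)
  algebraMap_mem' c v hv := by rw [algebraMap_smul]; exact P.smul_mem c hv

lemma mem_stabilizer_span {s : Set W} {a : Uq D q μ} (h : ∀ v ∈ s, a • v ∈ Submodule.span ℂ s) :
    a ∈ stabilizer D q μ (Submodule.span ℂ s) := by
  intro v hv
  induction hv using Submodule.span_induction with
  | mem v hv => exact h v hv
  | zero => rw [smul_zero]; exact Submodule.zero_mem _
  | add v v' _ _ hv hv' => rw [smul_add]; exact Submodule.add_mem _ hv hv'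
  | smul c v _ hv => rw [smul_smul_comm]; exact Submodule.smul_mem _ c hv

lemma xm_mem_stabilizer (w : W) (i : I) (r : ℤ) : Uq.x D q μ (-1) i r ∈
    stabilizer D q μ (Submodule.span ℂ (Set.range (lowering D q μ w))) := by
  refine mem_stabilizer_span ?_
  rintro _ ⟨l, rfl⟩
  exact lowering_mem_span w ((i, r) :: l)

/-- An element preserves the span of the lowering vectors if it maps `w` into this span and
if moving it across the `x_{j,r}^-` produces only terms already known to preserve it. -/
lemma mem_stabilizer_of_comm_xm (w : W) {t : Uq D q μ}
    (hw : t • w ∈ Submodule.span ℂ (Set.range (lowering D q μ w)))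
    (hx : ∀ j r, ∃ c : ℂ,
      ∃ b ∈ stabilizer D q μ (Submodule.span ℂ (Set.range (lowering D q μ w))),
        t * Uq.x D q μ (-1) j r = c • (Uq.x D q μ (-1) j r * t) + b) :
    t ∈ stabilizer D q μ (Submodule.span ℂ (Set.range (lowering D q μ w))) := by
  refine mem_stabilizer_span ?_
  rintro _ ⟨l, rfl⟩
  induction l with
  | nil => exact hw
  | cons a l ih =>
    obtain ⟨c, b, hb, h⟩ := hx a.1 a.2
    rw [lowering, ← mul_smul, h, add_smul, smul_assoc, mul_smul]
    exact Submodule.add_mem _ (Submodule.smul_mem _ _ (xm_mem_stabilizer w _ _ _ ih))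
      (hb _ (lowering_mem_span w l))

lemma phiInv_smul {w : W} {ε : ℤˣ} {i : I} {c : ℂ} (hw0 : w ≠ 0)
    (hw : Uq.phi D q μ ε i (shift μ i ε) • w = c • w) :
    c ≠ 0 ∧ Uq.gen D q μ (.phiInv ε i) • w = c⁻¹ • w := by
  have h : w = c • Uq.gen D q μ (.phiInv ε i) • w := by
    rw [← smul_smul_comm, ← hw, ← mul_smul, Uq.inv_mul_phi, one_smul]
  have hc : c ≠ 0 := by
    rintro rfl
    exact hw0 (by rw [h, zero_smul])
  exact ⟨hc, (eq_inv_smul_iff₀ hc).2 h.symm⟩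

/-- A highest `ℓ`-weight module is spanned by the vectors obtained from its highest weight vector
by applying the `x_{j,r}^-`. -/
lemma span_lowering_eq_top (hD : ∀ i, (D.qi q i : ℂ) - (D.qi q i : ℂ)⁻¹ ≠ 0) {w : W}
    (hw0 : w ≠ 0) (hspan : Submodule.span (Uq D q μ) {w} = ⊤)
    (hx : ∀ i r, Uq.x D q μ 1 i r • w = 0)
    (hphi : ∀ ε i r, ∃ c : ℂ, Uq.phi D q μ ε i r • w = c • w) :
    Submodule.span ℂ (Set.range (lowering D q μ w)) = ⊤ := by
  set P := Submodule.span ℂ (Set.range (lowering D q μ w))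
  have hwP : w ∈ P := lowering_mem_span w []
  have hphi0 : ∀ ε i, Uq.phi D q μ ε i (shift μ i ε) ∈ stabilizer D q μ P := fun ε i =>
    mem_stabilizer_of_comm_xm w (by
      obtain ⟨c, hc⟩ := hphi ε i (shift μ i ε)
      rw [hc]
      exact P.smul_mem c hwP) fun j r =>
        ⟨_, 0, Subalgebra.zero_mem _, by rw [Uq.phi_mul_x, add_zero]⟩
  have hinv : ∀ ε i, Uq.gen D q μ (.phiInv ε i) ∈ stabilizer D q μ P := fun ε i =>
    mem_stabilizer_of_comm_xm w (by
      obtain ⟨c, hc⟩ := hphi ε i (shift μ i ε)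
      rw [(phiInv_smul hw0 hc).2]
      exact P.smul_mem _ hwP) fun j r =>
        ⟨_, 0, Subalgebra.zero_mem _, by rw [Uq.phiInv_mul_x, add_zero]⟩
  have hh : ∀ i m, Uq.gen D q μ (.h i m) ∈ stabilizer D q μ P := fun i m =>
    mem_stabilizer_of_comm_xm w (by
      -- `w` is an eigenvector of the `φ_{i,r}^±`, hence of `h_{i,m}`
      have hmem : Uq.gen D q μ (.h i m) ∈ stabilizer D q μ (Submodule.span ℂ {w}) :=
        Uq.h_mem μ (hD i)
          (fun ε r => mem_stabilizer_span (by
            rintro _ rfl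
            obtain ⟨c, hc⟩ := hphi ε i r
            rw [hc]
            exact Submodule.smul_mem _ _ (Submodule.mem_span_singleton_self _)))
          (fun ε => mem_stabilizer_span (by
            rintro _ rfl
            obtain ⟨c, hc⟩ := hphi ε i (shift μ i ε)
            rw [(phiInv_smul hw0 hc).2]
            exact Submodule.smul_mem _ _ (Submodule.mem_span_singleton_self _))) m
      exact (Submodule.span_singleton_le_iff_mem _ _).2 hwP
        (hmem w (Submodule.mem_span_singleton_self w))) fun j r =>
        ⟨1, _, Subalgebra.smul_mem _ (xm_mem_stabilizer w j ((m : ℤ) + r)) _, by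
          rw [Uq.h_mul_x, one_smul]⟩
  have hphiP : ∀ ε i r, Uq.phi D q μ ε i r ∈ stabilizer D q μ P := fun ε i r =>
    Uq.phi_mem μ (fun ε => hphi0 ε i) (hh i) ε r
  have htop : stabilizer D q μ P = ⊤ := by
    refine Uq.subalgebra_eq_top D q μ _ fun g => ?_
    cases g with
    | x ε i r =>
      rcases Int.units_eq_one_or ε with rfl | rfl
      · refine mem_stabilizer_of_comm_xm w (by
          rw [← Uq.x_eq_gen, hx]; exact P.zero_mem) fun j s => ?_
        obtain ⟨c, hc⟩ := Uq.xp_mul_xm μ (hD i) j r s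
        exact ⟨1, _, Subalgebra.smul_mem _ (Subalgebra.sub_mem _ (hphiP 1 i _) (hphiP (-1) i _)) c,
          by rw [one_smul]; exact hc⟩
      · exact xm_mem_stabilizer w i r
    | phi ε i r => exact hphiP ε i r
    | phiInv ε i => exact hinv ε i
    | h i m => exact hh i m
  refine top_unique fun v _ => ?_
  obtain ⟨a, rfl⟩ := Submodule.mem_span_singleton.1 (hspan ▸ Submodule.mem_top : v ∈ _)
  exact (htop ▸ Algebra.mem_top : a ∈ stabilizer D q μ P) w hwP

/-- The weight of the lowering vector of `l` in a module of highest weight `c`. -/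
lemma phi_smul_lowering {w : W} {c : I → ℂˣ}
    (hc : ∀ i, Uq.phi D q μ 1 i 0 • w = (c i : ℂ) • w) (l : List (I × ℤ)) (i : I) :
    Uq.phi D q μ 1 i 0 • lowering D q μ w l =
      ((c i * D.qi q i ^ (-(l.map fun a => D.C i a.1).sum) : ℂˣ) : ℂ) • lowering D q μ w l := by
  induction l with
  | nil => simpa [lowering] using hc i
  | cons a l ih =>
    have h := Uq.phi_mul_x D q μ 1 (-1) i a.1 a.2
    rw [shift, if_pos rfl] at h
    rw [lowering, ← mul_smul, h, smul_assoc, mul_smul, ih, smul_smul_comm, smul_smul]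
    congr 1
    rw [List.map_cons, List.sum_cons, neg_add, zpow_add]
    push_cast
    simp only [one_mul, neg_mul]
    ring

/-- No nonempty sum of simple roots is trivial on the torus, as `q` is not a root of unity and the
symmetrized Cartan matrix is positive definite. -/
lemma exists_qi_zpow_ne_one [Fintype I]
    (hpos : (Matrix.of fun i j => (D.d i : ℝ) * (D.C i j : ℝ)).PosDef)
    (hq : ∀ n : ℕ, 0 < n → q ^ n ≠ 1) {l : List (I × ℤ)} (hl : l ≠ []) :
    ∃ i, D.qi q i ^ (-(l.map fun a => D.C i a.1).sum) ≠ 1 := by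
  classical
  by_contra! h
  set M : Matrix I I ℝ := Matrix.of fun i j => (D.d i : ℝ) * (D.C i j : ℝ) with hM
  -- `z l` is the tuple of multiplicities of the nodes in `l`
  let z : List (I × ℤ) → I → ℝ := fun l => (l.map fun a => Pi.single a.1 (1 : ℝ)).sum
  have hz : ∀ l, ∑ i, z l i = l.length := fun l => by
    induction l with
    | nil => simp [z]
    | cons a l ih =>
      simp only [z, List.map_cons, List.sum_cons, Pi.add_apply, Finset.sum_add_distrib] at ih ⊢
      rw [ih]
      simp [add_comm]
  have hMz : ∀ l i, (M.mulVec (z l)) i = (D.d i : ℝ) * ((l.map fun a => D.C i a.1).sum : ℤ) :=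
    fun l i => by
    induction l with
    | nil => simp [z]
    | cons a l ih =>
      simp only [z, List.map_cons, List.sum_cons, Matrix.mulVec_add, Pi.add_apply] at ih ⊢
      rw [ih]
      simp [hM, mul_add]
  have hz0 : z l ≠ 0 := fun h0 => by
    have := hz l
    rw [h0] at this
    simp only [Pi.zero_apply, Finset.sum_const_zero] at this
    exact hl (List.length_eq_zero_iff.1 (by exact_mod_cast this.symm))
  have hMz0 : M.mulVec (z l) = 0 := by
    funext i
    rw [hMz, Pi.zero_apply]
    have hi := h i
    rw [CartanDatum.qi, ← zpow_natCast, ← zpow_mul] at hi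
    have h0 : (D.d i : ℤ) * -(l.map fun a => D.C i a.1).sum = 0 := by
      by_contra hne
      refine hq _ (Int.natAbs_pos.2 hne) ?_
      rcases Int.natAbs_eq ((D.d i : ℤ) * -(l.map fun a => D.C i a.1).sum) with h' | h'
      · rw [h', zpow_natCast] at hi
        exact hi
      · rw [h', zpow_neg, inv_eq_one, zpow_natCast] at hi
        exact hi
    rw [mul_neg, neg_eq_zero] at h0
    exact_mod_cast h0
  have := hpos.dotProduct_mulVec_pos hz0
  rw [hMz0, dotProduct_zero] at this
  exact this.false

/-- A highest `ℓ`-weight module has a weight `γ₀`, that of its highest weight vector, such that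
every proper submodule lies in the sum of the weight spaces of the weights other than `γ₀`,
and this sum is not the whole module: the weight space of weight `γ₀` is a line that generates
the module. -/
lemma exists_highest_weight [Fintype I]
    (hd : ∀ i, 0 < D.d i)
    (hpos : (Matrix.of fun i j => (D.d i : ℝ) * (D.C i j : ℝ)).PosDef)
    (hq : ∀ n : ℕ, 0 < n → q ^ n ≠ 1) (hW : IsHighestLWeightModule D q μ W) :
    ∃ γ₀ : I → ℂˣ, (⨆ γ, ⨆ _ : γ ≠ γ₀, weightSpace D q μ W 1 γ) ≠ ⊤ ∧
      ∀ N : Submodule (Uq D q μ) W, N ≠ ⊤ →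
        N.restrictScalars ℂ ≤ ⨆ γ, ⨆ _ : γ ≠ γ₀, weightSpace D q μ W 1 γ := by
  classical
  obtain ⟨Ψ, -, -, w, hw0, hspan, hx, hphi⟩ := hW
  have hD : ∀ i, (D.qi q i : ℂ) - (D.qi q i : ℂ)⁻¹ ≠ 0 := fun i => qi_sub_inv_ne_zero hq (hd i)
  let γ₀ : I → ℂˣ := fun i =>
    Units.mk0 (ratCoeff 1 (Ψ i) 0) (phiInv_smul (ε := 1) (i := i) hw0 (hphi 1 i _)).1
  have hγ₀ : ∀ i, Uq.phi D q μ 1 i 0 • w = (γ₀ i : ℂ) • w := fun i => hphi 1 i 0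
  have hweight : ∀ l, lowering D q μ w l ∈ weightSpace D q μ W 1
      (fun i => γ₀ i * D.qi q i ^ (-(l.map fun a => D.C i a.1).sum)) := fun l i => by
    simpa [shift] using phi_smul_lowering hγ₀ l i
  set P : Submodule ℂ W := ⨆ γ, ⨆ _ : γ ≠ γ₀, weightSpace D q μ W 1 γ with hP
  have hw : w ∈ weightSpace D q μ W 1 γ₀ := by simpa [lowering] using hweight []
  have hlow : ∀ l ≠ [], lowering D q μ w l ∈ P := fun l hl => by
    obtain ⟨i, hi⟩ := exists_qi_zpow_ne_one hpos hq hl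
    refine Submodule.mem_iSup_of_mem _ (Submodule.mem_iSup_of_mem (fun h => hi ?_) (hweight l))
    simpa using congrFun h i
  have hsup : ∀ v : W, ∃ c : ℂ, ∃ p ∈ P, v = c • w + p := fun v => by
    have htop := span_lowering_eq_top hD hw0 hspan hx fun ε i r => ⟨_, hphi ε i r⟩
    have hle : Submodule.span ℂ (Set.range (lowering D q μ w)) ≤ Submodule.span ℂ {w} ⊔ P := by
      rw [Submodule.span_le]
      rintro _ ⟨l, rfl⟩
      by_cases hl : l = []
      · subst hl
        exact Submodule.mem_sup_left (Submodule.mem_span_singleton_self w)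
      · exact Submodule.mem_sup_right (hlow l hl)
    obtain ⟨y, hy, p, hp, rfl⟩ := Submodule.mem_sup.1 (hle (htop ▸ Submodule.mem_top : v ∈ _))
    obtain ⟨c, rfl⟩ := Submodule.mem_span_singleton.1 hy
    exact ⟨c, p, hp, rfl⟩
  refine ⟨γ₀, fun h => hw0 ?_, fun N hN n hn => ?_⟩
  · exact (Submodule.disjoint_def.1 ((iSupIndep_def.1 (iSupIndep_weightSpace 1)) γ₀)) w hw
      (show w ∈ P by rw [hP, h]; exact Submodule.mem_top)
  · obtain ⟨c, p, hp, rfl⟩ := hsup n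
    by_cases hc : c = 0
    · rwa [hc, zero_smul, zero_add]
    refine absurd ?_ hN
    -- the component `c • w` of an element of `N` lies in `N`
    have hcw : c • w ∈ N := by
      obtain ⟨f, hf, hfp⟩ := (Submodule.mem_iSup_iff_exists_finsupp _ p).1 hp
      have hf0 : f γ₀ = 0 := by simpa using hf γ₀
      have hfw : ∀ γ, f γ ∈ weightSpace D q μ W 1 γ := fun γ =>
        (iSup_le (fun _ => le_rfl) : _ ≤ weightSpace D q μ W 1 γ) (hf γ)
      have h := weight_components_mem N 1 (insert γ₀ f.support)
        (fun γ => f γ + if γ = γ₀ then c • w else 0) (fun γ _ => ?_) ?_ γ₀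
        (Finset.mem_insert_self _ _)
      · simpa [hf0] using h
      · refine Submodule.add_mem _ (hfw γ) ?_
        split_ifs with hγ
        exacts [hγ ▸ Submodule.smul_mem _ c hw, Submodule.zero_mem _]
      · rw [Finset.sum_add_distrib, Finset.sum_ite_eq', if_pos (Finset.mem_insert_self _ _),
          ← Finsupp.sum_of_support_subset f (Finset.subset_insert γ₀ _) (fun _ x => x) (by simp),
          hfp, add_comm]
        exact hn
    have hwN : w ∈ N := by simpa only [inv_smul_smul₀ hc] using N.smul_of_tower_mem c⁻¹ hcw
    rw [← top_le_iff, ← hspan, Submodule.span_singleton_le_iff_mem]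
    exact hwN

end HighestWeight

/-! ### The radical of an inflation -/

lemma jacobson_eq_of_forall_le {A M : Type*} [Ring A] [AddCommGroup M] [Module A M]
    {N₀ : Submodule A M} (h₀ : N₀ ≠ ⊤) (h : ∀ N : Submodule A M, N ≠ ⊤ → N ≤ N₀) :
    Module.jacobson A M = N₀ := by
  refine le_antisymm (sInf_le ⟨h₀, fun N hN => ?_⟩) (le_sInf fun N hN => ?_)
  · by_contra hne
    exact hN.not_ge (h N hne)
  · exact ((hN.le_iff.1 (h N hN.1)).resolve_left h₀).le

section Skew

variable {I : Type*} {D : CartanDatum I} {q : ℂˣ} {μ : I → ℤ} {J : Finset I}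

lemma incl_gen (g : Gen J) : incl D q μ J (Uq.gen _ q _ g) = Uq.gen D q μ (genIncl J g) := by
  have h : incl D q μ J (Uq.mk _ q _ (FreeAlgebra.ι ℂ g)) =
      Uq.mk D q μ (freeIncl J (FreeAlgebra.ι ℂ g)) := by
    exact RingQuot.liftAlgHom_mkAlgHom_apply ℂ _ _ _
  rw [freeIncl_ι] at h
  exact h

/-- The elements `a` of `U_q^ν(𝔤_J)` that can be moved across `t ∈ U_q^μ(𝔤)` at the cost of
replacing `a` by another element and of adding an element of `U_q^ν(𝔤_J)`. -/
def skewCommutant (t : Uq D q μ) : Subalgebra ℂ (Uq (D.restrict J) q (resCoweight J μ)) where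
  carrier := {a | ∃ b c, incl D q μ J a * t = t * incl D q μ J b + incl D q μ J c}
  mul_mem' := by
    rintro a a' ⟨b, c, h⟩ ⟨b', c', h'⟩
    refine ⟨b * b', c * b' + a * c', ?_⟩
    simp only [map_mul, map_add]
    rw [mul_assoc, h', mul_add, ← mul_assoc, h, add_mul, mul_assoc, add_assoc]
  add_mem' := by
    rintro a a' ⟨b, c, h⟩ ⟨b', c', h'⟩
    refine ⟨b + b', c + c', ?_⟩
    simp only [map_add]
    rw [add_mul, h, h', mul_add]
    abel
  algebraMap_mem' r := ⟨algebraMap ℂ _ r, 0, by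
    rw [AlgHom.commutes, map_zero, add_zero, Algebra.commutes]⟩

/-- The Cartan generators `φ_{i,0}^+`, `φ_{i,α_i(μ)}^-`, their inverses, and the `h_{i,m}`. -/
inductive Gen.IsBasicCartan (μ : I → ℤ) : Gen I → Prop
  | phi (ε : ℤˣ) (i : I) : IsBasicCartan μ (.phi ε i (shift μ i ε))
  | phiInv (ε : ℤˣ) (i : I) : IsBasicCartan μ (.phiInv ε i)
  | h (i : I) (m : {m : ℤ // m ≠ 0}) : IsBasicCartan μ (.h i m)

lemma Gen.IsBasicCartan.isCartan {g : Gen I} (hg : g.IsBasicCartan μ) : g.IsCartan := by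
  cases hg <;> trivial

/-- Moving an element of `U_q^ν(𝔤_J)` across a Cartan generator of `U_q^μ(𝔤)` only produces elements
of `U_q^ν(𝔤_J)`, even when the node of the Cartan generator is not in `J`. -/
lemma skewCommutant_eq_top (hD : ∀ i, (D.qi q i : ℂ) - (D.qi q i : ℂ)⁻¹ ≠ 0)
    {g : Gen I} (hg : g.IsBasicCartan μ) : skewCommutant (J := J) (Uq.gen D q μ g) = ⊤ := by
  refine Uq.subalgebra_eq_top _ q _ _ fun g' => ?_
  have hcomm (hg' : (genIncl J g').IsCartan) :
      Uq.gen _ q _ g' ∈ skewCommutant (Uq.gen D q μ g) :=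
    ⟨Uq.gen _ q _ g', 0, by
      rw [map_zero, add_zero, incl_gen]
      exact (Uq.cartan_commute μ hD hg' hg.isCartan).eq⟩
  cases g' with
  | x ε j r =>
    have hx : ∀ r, incl D q μ J (Uq.gen _ q _ (.x ε j r)) = Uq.x D q μ ε j r := fun r => incl_gen _
    cases hg with
    | phi ε' i =>
      refine ⟨((D.qi q i : ℂ) ^ ((ε' : ℤ) * (ε : ℤ) * D.C i j))⁻¹ • Uq.gen _ q _ (.x ε j r), 0, ?_⟩
      rw [map_zero, add_zero, map_smul, hx, mul_smul_comm, ← Uq.phi_eq_gen, Uq.phi_mul_x,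
        inv_smul_smul₀ (zpow_ne_zero _ (Units.ne_zero _))]
    | phiInv ε' i =>
      refine ⟨((D.qi q i : ℂ) ^ ((ε' : ℤ) * (ε : ℤ) * D.C i j)) • Uq.gen _ q _ (.x ε j r), 0, ?_⟩
      rw [map_zero, add_zero, map_smul, hx, mul_smul_comm, Uq.phiInv_mul_x,
        smul_inv_smul₀ (zpow_ne_zero _ (Units.ne_zero _))]
    | h i m =>
      refine ⟨Uq.gen _ q _ (.x ε j r),
        -((((ε : ℤ) : ℂ) * (1 / ((m : ℤ) : ℂ)) * qNum (D.qi q i : ℂ) ((m : ℤ) * D.C i j)) •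
          Uq.gen _ q _ (.x ε j ((m : ℤ) + r))), ?_⟩
      rw [map_neg, map_smul, hx, hx, Uq.h_mul_x, add_neg_cancel_right]
  | phi ε j r => exact hcomm trivial
  | phiInv ε j => exact hcomm trivial
  | h j m => exact hcomm trivial

end Skew

section Radical

variable {I : Type*} {D : CartanDatum I} {q : ℂˣ} {μ : I → ℤ} {J : Finset I}
  {W : Type*} [AddCommGroup W] [Module ℂ W] [Module (Uq (D.restrict J) q (resCoweight J μ)) W]
  [IsScalarTower ℂ (Uq (D.restrict J) q (resCoweight J μ)) W]
  {V : Type*} [AddCommGroup V] [Module ℂ V] [Module (Uq D q μ) V]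
  [IsScalarTower ℂ (Uq D q μ) V]

/-- An isomorphism `res_J^μ(V) ≃ W`, as a `ℂ`-linear isomorphism `V ≃ W`. -/
def resEquiv (e : Res D q μ J V ≃ₗ[Uq (D.restrict J) q (resCoweight J μ)] W) : V ≃ₗ[ℂ] W where
  toFun v := e v
  invFun w := e.symm w
  map_add' v v' := e.map_add v v'
  map_smul' c v := by
    have h : c • v = incl D q μ J (algebraMap ℂ _ c) • v := by
      rw [AlgHom.commutes, algebraMap_smul]
    rw [h]
    exact (e.map_smul (algebraMap ℂ _ c) _).trans (algebraMap_smul _ _ _)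
  left_inv v := e.symm_apply_apply v
  right_inv w := e.apply_symm_apply w

lemma resEquiv_incl_smul (e : Res D q μ J V ≃ₗ[Uq (D.restrict J) q (resCoweight J μ)] W)
    (a : Uq (D.restrict J) q (resCoweight J μ)) (v : V) :
    resEquiv e (incl D q μ J a • v) = a • resEquiv e v :=
  e.map_smul a (v : Res D q μ J V)

/-- Let `N₀` be the largest proper submodule of `W`. A Cartan generator `t` preserves the subspace
of `V` corresponding to `N₀`: for `v` in this subspace, `U_q^ν(𝔤_J) t v` has no component
of weight `γ₀`, as `t` preserves weights. -/
lemma cartan_smul_mem (hD : ∀ i, (D.qi q i : ℂ) - (D.qi q i : ℂ)⁻¹ ≠ 0)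
    (e : Res D q μ J V ≃ₗ[Uq (D.restrict J) q (resCoweight J μ)] W) {γ₀ : J → ℂˣ}
    (hγ₀ : (⨆ γ, ⨆ _ : γ ≠ γ₀, weightSpace (D.restrict J) q (resCoweight J μ) W 1 γ) ≠ ⊤)
    {N₀ : Submodule (Uq (D.restrict J) q (resCoweight J μ)) W}
    (hN₀ : N₀.restrictScalars ℂ ≤
      ⨆ γ, ⨆ _ : γ ≠ γ₀, weightSpace (D.restrict J) q (resCoweight J μ) W 1 γ)
    (hle : ∀ N : Submodule (Uq (D.restrict J) q (resCoweight J μ)) W, N ≠ ⊤ → N ≤ N₀)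
    {g : Gen I} (hg : g.IsBasicCartan μ) {v : V} (hv : resEquiv e v ∈ N₀) :
    resEquiv e (Uq.gen D q μ g • v) ∈ N₀ := by
  set P := ⨆ γ, ⨆ _ : γ ≠ γ₀, weightSpace (D.restrict J) q (resCoweight J μ) W 1 γ
  -- the action of the generator, transported to `W`
  let T : W →ₗ[ℂ] W := (resEquiv e).toLinearMap ∘ₗ
    { toFun := fun v : V => Uq.gen D q μ g • v
      map_add' := smul_add _
      map_smul' := fun c v => smul_smul_comm _ c v } ∘ₗ (resEquiv e).symm.toLinearMap
  have hT : ∀ v, T (resEquiv e v) = resEquiv e (Uq.gen D q μ g • v) := fun v => by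
    change resEquiv e (Uq.gen D q μ g • (resEquiv e).symm (resEquiv e v)) = _
    rw [LinearEquiv.symm_apply_apply]
  have hTP : P ≤ P.comap T := by
    refine iSup₂_le fun γ hγ w hw => ?_
    refine Submodule.mem_iSup_of_mem γ (Submodule.mem_iSup_of_mem hγ fun j => ?_)
    obtain ⟨v, rfl⟩ := (resEquiv e).surjective w
    have hc := (Uq.cartan_commute μ hD (g := .phi 1 (j : I) (shift μ j 1)) trivial hg.isCartan).eq
    have hi : incl D q μ J (Uq.phi (D.restrict J) q (resCoweight J μ) 1 j
        (shift (resCoweight J μ) j 1)) = Uq.gen D q μ (.phi 1 (j : I) (shift μ j 1)) := incl_gen _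
    rw [hT, ← resEquiv_incl_smul, hi, ← mul_smul, hc, mul_smul, ← hi, ← hT, resEquiv_incl_smul,
      hw j, map_smul, hT]
  refine hle (Submodule.span _ {resEquiv e (Uq.gen D q μ g • v)}) (fun htop => hγ₀ ?_)
    (Submodule.mem_span_singleton_self _)
  refine top_unique fun w _ => ?_
  obtain ⟨a, rfl⟩ := Submodule.mem_span_singleton.1 (htop ▸ Submodule.mem_top : w ∈ _)
  obtain ⟨b, c, hbc⟩ := (skewCommutant_eq_top hD hg ▸ Algebra.mem_top :
    a ∈ skewCommutant (Uq.gen D q μ g))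
  rw [← resEquiv_incl_smul, ← mul_smul, hbc, add_smul, mul_smul, map_add, ← hT, resEquiv_incl_smul,
    resEquiv_incl_smul]
  exact P.add_mem (hTP (hN₀ (N₀.smul_mem b hv))) (hN₀ (N₀.smul_mem c hv))

/-- The radicals of an inflation and of the inflated module correspond to each other. -/
lemma resEquiv_mem_rad_iff [Fintype I] (hD : D.IsSimple) (hq : ∀ n : ℕ, 0 < n → q ^ n ≠ 1)
    (hW : IsHighestLWeightModule (D.restrict J) q (resCoweight J μ) W)
    (e : Res D q μ J V ≃ₗ[Uq (D.restrict J) q (resCoweight J μ)] W)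
    (hx : ∀ i ∉ J, ∀ (ε : ℤˣ) (r : ℤ) (v : V), Uq.x D q μ ε i r • v = 0) (v : V) :
    resEquiv e v ∈ rad (Uq (D.restrict J) q (resCoweight J μ)) W ↔ v ∈ rad (Uq D q μ) V := by
  have hqi : ∀ i, (D.qi q i : ℂ) - (D.qi q i : ℂ)⁻¹ ≠ 0 := fun i =>
    qi_sub_inv_ne_zero hq (hD.d_pos i)
  obtain ⟨γ₀, hγ₀, hle⟩ := exists_highest_weight (D := D.restrict J) (fun j => hD.d_pos j)
    (hD.posDef.submatrix (Subtype.val_injective : Function.Injective (Subtype.val : J → I))) hq hW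
  set N₀ : Submodule (Uq (D.restrict J) q (resCoweight J μ)) W := sSup {N | N ≠ ⊤} with hN₀
  have hmax : ∀ N : Submodule (Uq (D.restrict J) q (resCoweight J μ)) W, N ≠ ⊤ → N ≤ N₀ :=
    fun N hN => le_sSup hN
  have hN₀P : N₀.restrictScalars ℂ ≤
      ⨆ γ, ⨆ _ : γ ≠ γ₀, weightSpace (D.restrict J) q (resCoweight J μ) W 1 γ := by
    rw [hN₀, Submodule.restrictScalars_sSup]
    refine sSup_le ?_
    rintro _ ⟨N, hN, rfl⟩
    exact hle N hN
  have hN₀top : N₀ ≠ ⊤ := fun h => hγ₀ (top_unique fun w _ => hN₀P (h ▸ Submodule.mem_top : w ∈ N₀))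
  -- the subspace of `V` corresponding to `N₀` is a submodule for the larger algebra
  set Q : Submodule ℂ V := (N₀.restrictScalars ℂ).comap (resEquiv e).toLinearMap
  have hbasic : ∀ g : Gen I, g.IsBasicCartan μ → Uq.gen D q μ g ∈ stabilizer D q μ Q :=
    fun g hg v hv => cartan_smul_mem hqi e hγ₀ hN₀P hmax hg hv
  have hstab : stabilizer D q μ Q = ⊤ := by
    refine Uq.subalgebra_eq_top D q μ _ fun g => ?_
    cases g with
    | x ε i r =>
      intro v hv
      by_cases hi : i ∈ J
      · have h : Uq.gen D q μ (.x ε i r) =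
          incl D q μ J (Uq.gen _ q _ (.x ε (⟨i, hi⟩ : J) r)) :=
          (incl_gen (J := J) (.x ε ⟨i, hi⟩ r)).symm
        rw [h]
        change resEquiv e _ ∈ N₀
        rw [resEquiv_incl_smul]
        exact N₀.smul_mem _ hv
      · rw [← Uq.x_eq_gen, hx i hi]
        exact Q.zero_mem
    | phi ε i r =>
      exact Uq.phi_mem μ (fun ε => hbasic _ (.phi ε i)) (fun m => hbasic _ (.h i m)) ε r
    | phiInv ε i => exact hbasic _ (.phiInv ε i)
    | h i m => exact hbasic _ (.h i m)
  let Q' : Submodule (Uq D q μ) V :=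
    { Q with smul_mem' := fun a v hv => (hstab ▸ Algebra.mem_top : a ∈ stabilizer D q μ Q) v hv }
  have hQ'top : Q' ≠ ⊤ := fun h => hN₀top (top_unique fun w _ => by
    obtain ⟨v, rfl⟩ := (resEquiv e).surjective w
    exact (h ▸ Submodule.mem_top : v ∈ Q'))
  have hQ'max : ∀ M : Submodule (Uq D q μ) V, M ≠ ⊤ → M ≤ Q' := fun M hM v hv => by
    let N : Submodule (Uq (D.restrict J) q (resCoweight J μ)) W :=
      { (M.restrictScalars ℂ).map (resEquiv e).toLinearMap with
        smul_mem' := by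
          rintro a _ ⟨v, hv, rfl⟩
          exact ⟨incl D q μ J a • v, M.smul_mem _ hv, resEquiv_incl_smul e a v⟩ }
    refine hmax N (fun h => hM (top_unique fun u _ => ?_)) ⟨v, hv, rfl⟩
    obtain ⟨u', hu', hu⟩ := (h ▸ Submodule.mem_top : resEquiv e u ∈ N)
    exact (resEquiv e).injective hu ▸ hu'
  rw [rad, rad, jacobson_eq_of_forall_le hN₀top hmax, jacobson_eq_of_forall_le hQ'top hQ'max]
  rfl

end Radical

end ShiftedAffine

theorem mainTheorem5 {I : Type*} [Fintype I] (D : CartanDatum I) (hD : D.IsSimple)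
    (q : ℂˣ) (hq : ∀ n : ℕ, 0 < n → q ^ n ≠ 1)
    (J : Finset I) (μ : I → ℤ)
    (W : Type*) [AddCommGroup W] [Module ℂ W] [Module (Uq (D.restrict J) q (resCoweight J μ)) W]
    [IsScalarTower ℂ (Uq (D.restrict J) q (resCoweight J μ)) W]
    (hW : IsHighestLWeightModule (D.restrict J) q (resCoweight J μ) W)
    (V : Type*) [AddCommGroup V] [Module ℂ V] [Module (Uq D q μ) V]
    [IsScalarTower ℂ (Uq D q μ) V]
    (hV : IsInflation D q μ J W V) :
    IsInflation D q μ J (rad (Uq (D.restrict J) q (resCoweight J μ)) W) (rad (Uq D q μ) V) ∧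
    IsInflation D q μ J (Head (Uq (D.restrict J) q (resCoweight J μ)) W) (Head (Uq D q μ) V) := by
  obtain ⟨e⟩ := hV.res_iso
  have hrad := resEquiv_mem_rad_iff hD hq hW e hV.x_smul_eq_zero
  refine ⟨⟨hV.source_mem.submodule _, hV.target_mem.submodule _, ?_, ?_⟩,
    ⟨hV.source_mem.quotient _, hV.target_mem.quotient _, ?_, ?_⟩⟩
  · -- the isomorphism is the restriction of `e`
    let f : Res D q μ J (rad (Uq D q μ) V) →ₗ[Uq (D.restrict J) q (resCoweight J μ)]
        rad (Uq (D.restrict J) q (resCoweight J μ)) W :=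
      { toFun := fun v => ⟨resEquiv e (show rad (Uq D q μ) V from v).1, (hrad _).2 v.2⟩
        map_add' := fun v v' => Subtype.ext (map_add (resEquiv e) _ _)
        map_smul' := fun a v => Subtype.ext (resEquiv_incl_smul e a _) }
    refine ⟨LinearEquiv.ofBijective f ⟨fun v v' h => ?_, fun w => ?_⟩⟩
    · exact Subtype.ext ((resEquiv e).injective (congrArg Subtype.val h))
    · obtain ⟨v, hv⟩ := (resEquiv e).surjective w.1
      exact ⟨⟨v, (hrad v).1 (hv ▸ w.2)⟩, Subtype.ext hv⟩
  · exact fun i hi ε r v => Subtype.ext (hV.x_smul_eq_zero i hi ε r v)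
  · -- the isomorphism is induced by the surjection `W → V → V / rad V`, whose kernel is `rad W`
    let f : W →ₗ[Uq (D.restrict J) q (resCoweight J μ)] Res D q μ J (Head (Uq D q μ) V) :=
      { toFun := fun w => (rad (Uq D q μ) V).mkQ ((resEquiv e).symm w)
        map_add' := fun w w' => by rw [map_add, map_add]; rfl
        map_smul' := fun a w => by
          obtain ⟨v, rfl⟩ := (resEquiv e).surjective w
          rw [← resEquiv_incl_smul, LinearEquiv.symm_apply_apply, LinearEquiv.symm_apply_apply,
            map_smul]
          rfl }
    have hker : LinearMap.ker f = rad (Uq (D.restrict J) q (resCoweight J μ)) W := by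
      ext w
      obtain ⟨v, rfl⟩ := (resEquiv e).surjective w
      rw [hrad, LinearMap.mem_ker, ← Submodule.Quotient.mk_eq_zero]
      change (rad (Uq D q μ) V).mkQ ((resEquiv e).symm (resEquiv e v)) = 0 ↔ _
      rw [LinearEquiv.symm_apply_apply]
      rfl
    have hsurj : Function.Surjective f := fun u => by
      obtain ⟨v, rfl⟩ := (rad (Uq D q μ) V).mkQ_surjective u
      refine ⟨resEquiv e v, ?_⟩
      change (rad (Uq D q μ) V).mkQ ((resEquiv e).symm (resEquiv e v)) = _
      rw [LinearEquiv.symm_apply_apply]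
    exact ⟨((Submodule.quotEquivOfEq _ _ hker.symm).trans (f.quotKerEquivOfSurjective hsurj)).symm⟩
  · intro i hi ε r u
    obtain ⟨v, rfl⟩ := (rad (Uq D q μ) V).mkQ_surjective u
    rw [← map_smul, hV.x_smul_eq_zero i hi, map_zero]
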